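/- Let $d,m\ge 1$ be integers, let $|\cdot|$ be the Euclidean norm on $\mathbb R^d$ and $|A|=\sqrt{\operatorname{tr}(A^TA)}$ for $A\in\mathbb R^{d\times m}$, and let $B$ be an $m$-dimensional standard Brownian motion on a probability space $(\Omega,\mathcal F,\mathbb P)$. Let $f:\mathbb R^d\to\mathbb R^d$ and $g:\mathbb R^d\to\mathbb R^{d\times m}$ be locally Lipschitz (Lipschitz on every ball $\{|x|\le N\}$) with $f(0)=0$ and $g(0)=0$, and for $U:\mathbb R^d\to\mathbb R$ put $$\mathcal L U(x)=\langle D^{(1)}U(x),f(x)\rangle+\tfrac12\operatorname{tr}\big[g(x)^T D^{(2)}U(x)\,g(x)\big],$$ where $D^{(1)}U$ is the gradient and $D^{(2)}U$ the Hessian matrix of $U$, and $\mathcal LU(x):=0$ if $f(x)=0$ and $g(x)=0$. Let $|D^{(n)}U(x)|$ be the Euclidean norm of the family $\big(\partial^nU(x)/\partial x_{i_1}\cdots\partial x_{i_n}\big)_{1\le i_1,\dots,i_n\le d}$. Let $\rho>0$, $\mu>0$, and let $\delta_4>0$ be such that $1/\delta_4$ is an integer $\ge 4$. Let $V\in C^4(\mathbb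 R^d;[0,\infty))$ satisfy * $V(x)\to\infty$ as $|x|\to\infty$, and $V(x)=0$ if and only if $x=0$; * there is $c>0$ with $|D^{(n)}V(x)|\le c\,V(x)^{1-n\delta_4}$ for all $x\in\mathbb R^d$ and $n=1,2,3,4$ (where $0^0=1$); * $V(\epsilon x)\le V(x)$ for all $x\in\mathbb R^d$ and $0<\epsilon\le1$; and let $w:\mathbb R^d\to[0,\infty)$ be continuous with $$\mathcal L V^\rho(x)\le -w(x)\quad\text{and}\quad w(x)\ge\mu V^\rho(x)\qquad\text{for all }x\in\mathbb R^d .$$ Put $\Lambda_\rho(x)=1\wedge\big(w(x)/V^\rho(x)\big)$ for $x\neq0$ and assume that for every $u>0$ $$\sup_{0<|x|\le u}\frac{|f(x)|^2\vee|g(x)|^2}{\Lambda_\rho(x)V^{2\delta_4}(x)}<\infty .$$ Let $\bar\varphi:(0,\infty)\to(0,\infty)$ be strictly increasing and continuous with $\bar\varphi(u)\to\infty$ as $u\to\infty$ and $$\sup_{0<|x|\le u}\Big[\frac{|f(x)|}{\Lambda_\rho^{1/2}(x)V^{\delta_4}(x)}\vee\frac{|g(x)|^2}{\Lambda_\rho(x)V^{2\delta_4}(x)}\Big]\le\bar\varphi(u)\qquad\text{for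 all }u\ge1 .$$ Let $x_0\in\mathbb R^d$, $0<\bar\theta<1/2$, $K>0$ and $\Delta^*\in(0,1)$ satisfy $K(\Delta^*)^{-\bar\theta}\ge\bar\varphi(|x_0|\vee1)$. For $\Delta\in(0,\Delta^*]$ let $\bar\pi_\Delta(x)=\big(|x|\wedge\bar\varphi^{-1}(K\Delta^{-\bar\theta})\big)\frac{x}{|x|}$, with $\frac{x}{|x|}=0$ for $x=0$, and define the $V$-truncated Euler–Maruyama scheme $$Z_0=x_0,\qquad Z_{k+1}=\bar\pi_\Delta\Big(Z_k+f(Z_k)\Delta+g(Z_k)\big(B((k+1)\Delta)-B(k\Delta)\big)\Big),\qquad k\ge0 .$$ Then for every $\varrho\in(0,\mu)$ there is $\Delta^{**}\in(0,\Delta^*]$ such that for every $\Delta\in(0,\Delta^{**}]$ (with $\log 0=-\infty$) $$\limsup_{k\to\infty}\frac{\log \mathbb E V^\rho(Z_k)}{k\Delta}\le-(\mu-\varrho)<0,$$ and $$\limsup_{k\to\infty}\frac{\log V(Z_k)}{k\Delta}\le-\frac{\mu-\varrho}{\rho}\qquad\text{almost surely.}$$ -/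

import Mathlib

open Set Filter Topology MeasureTheory ProbabilityTheory
open scoped NNReal ENNReal Matrix

noncomputable section

namespace VTruncatedEM

/-- The norm `|A| = √(trace (Aᵀ A))` of a matrix. -/
def traceNorm {d m : ℕ} (A : Matrix (Fin d) (Fin m) ℝ) : ℝ :=
  Real.sqrt (Aᵀ * A).trace

/-- The `n`-th order partial derivative `∂ⁿU / ∂x_{ι 0} ⋯ ∂x_{ι (n-1)}` at `x`. -/
def partialDeriv {d : ℕ} (n : ℕ) (U : EuclideanSpace ℝ (Fin d) → ℝ) (ι : Fin n → Fin d)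
    (x : EuclideanSpace ℝ (Fin d)) : ℝ :=
  iteratedFDeriv ℝ n U x (fun k => EuclideanSpace.single (ι k) (1 : ℝ))

/-- `|D^{(n)} U(x)|`: the Euclidean norm in `ℝ^(d^n)` of the family of all `n`-th order partial
derivatives of `U` at `x`. -/
def derivNorm {d : ℕ} (n : ℕ) (U : EuclideanSpace ℝ (Fin d) → ℝ)
    (x : EuclideanSpace ℝ (Fin d)) : ℝ :=
  Real.sqrt (∑ ι : Fin n → Fin d, partialDeriv n U ι x ^ 2)

/-- The generator of `dX = f(X) dt + g(X) dB`:
`ℒU(x) = ⟨D^{(1)}U(x), f(x)⟩ + (1/2) tr[gᵀ(x) D^{(2)}U(x) g(x)]`.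
At a point where `f` and `g` vanish the value is `0`, whether or not `U` is differentiable there;
for `U = V^ρ` with `V` vanishing only at the origin this concerns only the equilibrium `0`. -/
def generator {d m : ℕ} (f : EuclideanSpace ℝ (Fin d) → EuclideanSpace ℝ (Fin d))
    (g : EuclideanSpace ℝ (Fin d) → Matrix (Fin d) (Fin m) ℝ)
    (U : EuclideanSpace ℝ (Fin d) → ℝ) (x : EuclideanSpace ℝ (Fin d)) : ℝ :=
  (∑ i : Fin d, partialDeriv 1 U ![i] x * f x i) +
    (1 / 2) * ((g x)ᵀ * (Matrix.of fun i j : Fin d => partialDeriv 2 U ![i, j] x) * g x).trace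

/-- The local Lipschitz condition on the coefficients. -/
def LocallyLipschitzCoeff {d m : ℕ}
    (f : EuclideanSpace ℝ (Fin d) → EuclideanSpace ℝ (Fin d))
    (g : EuclideanSpace ℝ (Fin d) → Matrix (Fin d) (Fin m) ℝ) : Prop :=
  ∀ N : ℝ, 0 < N → ∃ C : ℝ, 0 < C ∧ ∀ x y : EuclideanSpace ℝ (Fin d), max ‖x‖ ‖y‖ ≤ N →
    max ‖f x - f y‖ (traceNorm (g x - g y)) ≤ C * ‖x - y‖

/-- The class `𝒱̄^p_δ` of nonnegative `C^p` functions `V` on `ℝ^d` with `V(x) → ∞` as `|x| → ∞`,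
with `V(x) = 0` exactly for `x = 0`, and with `|D^{(n)}V| ≤ c V^{1 - nδ}` for `n = 1, …, p`. -/
structure IsLyapunovClass {d : ℕ} (p : ℕ) (δ : ℝ) (V : EuclideanSpace ℝ (Fin d) → ℝ) : Prop where
  contDiff : ContDiff ℝ p V
  nonneg : ∀ x, 0 ≤ V x
  tendsto_infty : Tendsto V (comap (fun x : EuclideanSpace ℝ (Fin d) => ‖x‖) atTop) atTop
  ker_eq : {x | V x = 0} = {0}
  deriv_le : ∃ c : ℝ, 0 < c ∧ ∀ n : ℕ, 1 ≤ n → n ≤ p → ∀ x : EuclideanSpace ℝ (Fin d),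
    derivNorm n V x ≤ c * V x ^ (1 - (n : ℝ) * δ)

/-- `Λ_ρ(x) = 1 ∧ (w(x) / V^ρ(x))`. -/
def capRatio {d : ℕ} (V w : EuclideanSpace ℝ (Fin d) → ℝ) (ρ : ℝ)
    (x : EuclideanSpace ℝ (Fin d)) : ℝ :=
  min 1 (w x / V x ^ ρ)

/-- The inverse function of a map `φ` that is injective on `(0, ∞)`. -/
def inversePos (φ : ℝ → ℝ) (y : ℝ) : ℝ :=
  Function.invFunOn φ (Ioi 0) y

/-- The map `x ↦ (|x| ∧ R) x / |x|`, with `x / |x| = 0` for `x = 0`. -/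
def radialTruncation {d : ℕ} (R : ℝ) (x : EuclideanSpace ℝ (Fin d)) : EuclideanSpace ℝ (Fin d) :=
  min ‖x‖ R • (‖x‖⁻¹ • x)

/-- `B` is an `m`-dimensional standard Brownian motion under `P`: its coordinates are independent
real standard Brownian motions. -/
structure IsBrownianMotion {Ω : Type*} [MeasurableSpace Ω] {m : ℕ}
    (B : ℝ≥0 → Ω → EuclideanSpace ℝ (Fin m)) (P : Measure Ω) : Prop where
  measurable : ∀ t, Measurable (B t)
  isBrownianReal_coord : ∀ j : Fin m, IsBrownianReal (fun t ω => B t ω j) P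
  indep_coord : iIndepFun (fun (j : Fin m) (ω : Ω) (t : ℝ≥0) => B t ω j) P

/-- The `V`-truncated Euler–Maruyama scheme with step size `Δ`, truncation function `φ`,
constants `K`, `θ`, driven by `B`:
`Z₀ = x₀`, `Z_{k+1} = π_Δ(Z_k + f(Z_k) Δ + g(Z_k) (B(t_{k+1}) - B(t_k)))` with `t_k = kΔ` and
`π_Δ` the truncation at radius `φ⁻¹(K Δ^{-θ})`. -/
def scheme {Ω : Type*} {d m : ℕ} (f : EuclideanSpace ℝ (Fin d) → EuclideanSpace ℝ (Fin d))
    (g : EuclideanSpace ℝ (Fin d) → Matrix (Fin d) (Fin m) ℝ) (φ : ℝ → ℝ) (K θ : ℝ)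
    (x₀ : EuclideanSpace ℝ (Fin d)) (B : ℝ≥0 → Ω → EuclideanSpace ℝ (Fin m)) (Δ : ℝ) :
    ℕ → Ω → EuclideanSpace ℝ (Fin d)
  | 0, _ => x₀
  | k + 1, ω =>
    let z := scheme f g φ K θ x₀ B Δ k ω
    let dB := B (((k : ℝ) + 1) * Δ).toNNReal ω - B ((k : ℝ) * Δ).toNNReal ω
    radialTruncation (inversePos φ (K * Δ ^ (-θ)))
      (z + Δ • f z + WithLp.toLp 2 (g z *ᵥ dB.ofLp))

end VTruncatedEM

end

open VTruncatedEM

/-! One untruncated Euler step from a state z satisfies E V^ρ ≤ V^ρ(z)(1 + C(AΔ)²) + Δ·ℒV^ρ(z)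
whenever |f(z)| ≤ A V^δ(z), |g(z)|² ≤ A V^{2δ}(z) and AΔ ≤ 1 (`exists_lintegral_step_le`). The
truncation radius R solves φ(R) = A := KΔ^{-θ}, so these bounds hold at every state the scheme
visits. Since θ < 1/2, the error C(AΔ)² = CK²Δ^{2-2θ} is at most ϱΔ for small Δ, while ℒV^ρ ≤ -μV^ρ.
One step therefore contracts E V^ρ by 1 - (μ-ϱ)Δ ≤ e^{-(μ-ϱ)Δ}, and truncating afterwards only
lowers V. Independence of the increments iterates this, and a weighted summation over k turns moment
decay into almost sure decay.

The step estimate rests on two ideas. The Gaussian law is symmetric, so ξ and -ξ may be averaged.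
With t = √Δ this is a symmetric second difference of V^ρ along the parabola z + t²f(z) + t g(z)ξ:
the odd Taylor terms cancel, the second-order term averages to the generator, and the remainder is
of order t⁴ (`exists_symmetric_difference_le`). The constants are uniform in z because the class
|DⁿV| ≤ cV^{1-nδ} is invariant under η ↦ V(z + V(z)^δ η)/V(z) (`HasPowerBound.rescale`). This
reduces everything to functions with value 1 at the origin. For these, the Lipschitz property of v^δ
gives two-sided bounds near 0 and polynomial growth globally. -/

namespace VTruncatedEM

/-! ### Consequences of the power bounds on derivatives; symmetric Taylor expansion. -/

section LyapunovBound

variable {E : Type*} [NormedAddCommGroup E] [NormedSpace ℝ E]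

/-- Nonnegative `C⁴` functions whose derivatives satisfy `‖DⁿV‖ ≤ c V^{1 - nδ}` for `n = 1, …, 4`,
the derivatives being measured in operator norm. -/
structure HasPowerBound (c δ : ℝ) (v : E → ℝ) : Prop where
  contDiff : ContDiff ℝ 4 v
  nonneg : ∀ x, 0 ≤ v x
  bound : ∀ n : ℕ, 1 ≤ n → n ≤ 4 → ∀ x, ‖iteratedFDeriv ℝ n v x‖ ≤ c * v x ^ (1 - (n : ℝ) * δ)

lemma HasPowerBound.const_nonneg {c δ : ℝ} {v : E → ℝ} (hv : HasPowerBound c δ v) {x : E}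
    (hx : 0 < v x) : 0 ≤ c := by
  have h := (norm_nonneg _).trans (hv.bound 1 le_rfl (by norm_num) x)
  exact nonneg_of_mul_nonneg_left h (Real.rpow_pos_of_pos hx _)

/-- The power `v^δ` is globally Lipschitz. -/
lemma HasPowerBound.abs_rpow_sub_le {c δ : ℝ} {v : E → ℝ} (hv : HasPowerBound c δ v)
    (hc : 0 ≤ c) (hδ : 0 < δ) (hδ1 : δ < 1) (x y : E) :
    |v y ^ δ - v x ^ δ| ≤ c * δ * ‖y - x‖ := by
  -- Where v vanishes, v^δ need not be differentiable. The shift by ε restores smoothness and keeps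
  -- the gradient bound cδ, which is independent of ε.
  have key : ∀ ε : ℝ, 0 < ε → |(v y + ε) ^ δ - (v x + ε) ^ δ| ≤ c * δ * ‖y - x‖ := by
    intro ε hε
    have hpos : ∀ z, 0 < v z + ε := fun z => add_pos_of_nonneg_of_pos (hv.nonneg z) hε
    have hder : ∀ z ∈ (univ : Set E), HasFDerivWithinAt (fun z => (v z + ε) ^ δ)
        ((δ * (v z + ε) ^ (δ - 1)) • fderiv ℝ v z) univ z := by
      intro z _
      have h1 : HasFDerivAt v (fderiv ℝ v z) z :=
        (hv.contDiff.differentiable (by norm_num) z).hasFDerivAt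
      exact ((h1.add_const ε).rpow_const (Or.inl (hpos z).ne')).hasFDerivWithinAt
    refine convex_univ.norm_image_sub_le_of_norm_hasFDerivWithin_le hder ?_ (mem_univ x)
      (mem_univ y)
    intro z _
    have h2 : ‖fderiv ℝ v z‖ ≤ c * v z ^ (1 - δ) := by
      have h3 := hv.bound 1 le_rfl (by norm_num) z
      rw [norm_iteratedFDeriv_one] at h3
      simpa using h3
    have h4 : v z ^ (1 - δ) ≤ (v z + ε) ^ (1 - δ) :=
      Real.rpow_le_rpow (hv.nonneg z) (by linarith) (by linarith)
    have h5 : (v z + ε) ^ (δ - 1) * (v z + ε) ^ (1 - δ) = 1 := by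
      rw [← Real.rpow_add (hpos z)]; simp
    rw [norm_smul, Real.norm_of_nonneg (by have := hpos z; positivity)]
    calc δ * (v z + ε) ^ (δ - 1) * ‖fderiv ℝ v z‖
        ≤ δ * (v z + ε) ^ (δ - 1) * (c * (v z + ε) ^ (1 - δ)) := by
          have := hpos z
          gcongr
          exact h2.trans (by gcongr)
      _ = c * δ * ((v z + ε) ^ (δ - 1) * (v z + ε) ^ (1 - δ)) := by ring
      _ = c * δ := by rw [h5, mul_one]
  have hlim : ∀ z, Tendsto (fun ε : ℝ => (v z + ε) ^ δ) (𝓝[>] 0) (𝓝 (v z ^ δ)) := by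
    intro z
    have : Continuous fun ε : ℝ => (v z + ε) ^ δ :=
      (continuous_const.add continuous_id).rpow_const fun _ => Or.inr hδ.le
    simpa using (this.tendsto 0).mono_left nhdsWithin_le_nhds
  refine le_of_tendsto ((hlim y).sub (hlim x)).abs ?_
  filter_upwards [self_mem_nhdsWithin] with ε hε using key ε hε

lemma rpow_one_div_natCast_pow {a δ : ℝ} {r : ℕ} (ha : 0 ≤ a) (hr : δ * r = 1) :
    (a ^ δ) ^ r = a := by
  rw [← Real.rpow_mul_natCast ha, hr, Real.rpow_one]

/-- Global polynomial growth of `v^ρ`. -/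
lemma HasPowerBound.rpow_le {c δ ρ : ℝ} {r N : ℕ} {v : E → ℝ} (hv : HasPowerBound c δ v)
    (hc : 0 ≤ c) (hδ : 0 < δ) (hδ1 : δ < 1) (hr : δ * r = 1) (hρ : 0 < ρ) (hN : ρ * r ≤ N)
    (h0 : v 0 = 1) (x : E) :
    v x ^ ρ ≤ (1 + c * δ * ‖x‖) ^ N := by
  have h1 := hv.abs_rpow_sub_le hc hδ hδ1 0 x
  rw [h0, Real.one_rpow, sub_zero] at h1
  have h2 : v x ^ δ ≤ 1 + c * δ * ‖x‖ := by linarith [le_abs_self (v x ^ δ - 1)]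
  have h3 : 1 ≤ 1 + c * δ * ‖x‖ := by
    have : 0 ≤ c * δ * ‖x‖ := by positivity
    linarith
  calc v x ^ ρ = (v x ^ δ) ^ (ρ * r) := by
        rw [← Real.rpow_mul (hv.nonneg x)]; congr 1; linear_combination (-ρ) * hr
    _ ≤ (1 + c * δ * ‖x‖) ^ (ρ * r) :=
        Real.rpow_le_rpow (Real.rpow_nonneg (hv.nonneg x) _) h2 (by positivity)
    _ ≤ (1 + c * δ * ‖x‖) ^ (N : ℝ) := Real.rpow_le_rpow_of_exponent_le h3 hN
    _ = _ := Real.rpow_natCast _ _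

/-- Near the origin `v` stays between two positive constants. -/
lemma HasPowerBound.mem_Icc {c δ : ℝ} {r : ℕ} {v : E → ℝ} (hv : HasPowerBound c δ v)
    (hc : 0 ≤ c) (hδ : 0 < δ) (hδ1 : δ < 1) (hr : δ * r = 1)
    (h0 : v 0 = 1) {x : E} (hx : c * δ * ‖x‖ ≤ 1 / 2) :
    v x ∈ Icc ((1 / 2 : ℝ) ^ r) (2 ^ r) := by
  have h1 := hv.abs_rpow_sub_le hc hδ hδ1 0 x
  rw [h0, Real.one_rpow, sub_zero] at h1
  have h2 := abs_le.1 (h1.trans hx)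
  rw [← rpow_one_div_natCast_pow (hv.nonneg x) hr]
  exact ⟨pow_le_pow_left₀ (by norm_num) (by linarith) r,
    pow_le_pow_left₀ (Real.rpow_nonneg (hv.nonneg x) _) (by linarith) r⟩

/-- The power function is smooth away from 0, so compactness of [a, b] bounds its derivatives.
Summing the five bounds yields one constant for all orders. -/
lemma exists_bound_iteratedFDerivWithin_rpow (ρ a b : ℝ) (ha : 0 < a) :
    ∃ C : ℝ, 0 ≤ C ∧ ∀ i : ℕ, i ≤ 4 → ∀ y ∈ Icc a b,
      ‖iteratedFDerivWithin ℝ i (fun y : ℝ => y ^ ρ) (Ioi 0) y‖ ≤ C := by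
  have hcd : ContDiffOn ℝ 4 (fun y : ℝ => y ^ ρ) (Ioi 0) := fun y hy =>
    (Real.contDiffAt_rpow_const_of_ne (ne_of_gt hy)).contDiffWithinAt
  have h : ∀ i : ℕ, ∃ C : ℝ, i ≤ 4 → ∀ y ∈ Icc a b,
      ‖iteratedFDerivWithin ℝ i (fun y : ℝ => y ^ ρ) (Ioi 0) y‖ ≤ C := by
    intro i
    by_cases hi : i ≤ 4
    · have hcont := hcd.continuousOn_iteratedFDerivWithin (m := i) (by exact_mod_cast hi)
        (uniqueDiffOn_Ioi 0)
      obtain ⟨C, hC⟩ := (isCompact_Icc (a := a) (b := b)).exists_bound_of_continuousOn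
        (hcont.mono fun y hy => lt_of_lt_of_le ha hy.1)
      exact ⟨C, fun _ => hC⟩
    · exact ⟨0, fun h => absurd h hi⟩
  choose C hC using h
  refine ⟨∑ i ∈ Finset.range 5, |C i|, Finset.sum_nonneg fun _ _ => abs_nonneg _, ?_⟩
  intro i hi y hy
  refine (hC i hi y hy).trans ((le_abs_self _).trans ?_)
  exact Finset.single_le_sum (f := fun i => |C i|) (fun _ _ => abs_nonneg _)
    (Finset.mem_range.2 (by omega))

/-- Uniform bound on the derivatives of `v^ρ` near the origin. -/
lemma exists_bound_iteratedFDeriv_rpow (E : Type*) [NormedAddCommGroup E] [NormedSpace ℝ E]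
    (c δ ρ : ℝ) (r : ℕ) (hc : 0 ≤ c) (hδ : 0 < δ) (hδ4 : 4 * δ ≤ 1) (hr : δ * r = 1) :
    ∃ M : ℝ, 0 ≤ M ∧ ∀ v : E → ℝ, HasPowerBound c δ v → v 0 = 1 → ∀ x, c * δ * ‖x‖ ≤ 1 / 2 →
      ∀ i : ℕ, i ≤ 4 → ‖iteratedFDeriv ℝ i (fun y => v y ^ ρ) x‖ ≤ M := by
  obtain ⟨C, hC0, hC⟩ := exists_bound_iteratedFDerivWithin_rpow ρ ((1 / 2 : ℝ) ^ r) (2 ^ r)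
    (by positivity)
  set D : ℝ := max 1 (c * 2 ^ r) with hD
  have hD1 : 1 ≤ D := le_max_left _ _
  -- The Faà di Bruno estimate for a composition gives i!·C·Dⁱ when the outer derivatives are at
  -- most C and the j-th inner one is at most Dʲ. Taking D ≥ 1 makes one constant serve every order
  -- up to 4.
  refine ⟨Nat.factorial 4 * C * D ^ 4, by positivity, ?_⟩
  intro v hv h0 x hx i hi
  have hmem := hv.mem_Icc hc hδ (by linarith) hr h0 hx
  have hopen : IsOpen {y | 0 < v y} := isOpen_lt continuous_const hv.contDiff.continuous
  have hxs : x ∈ {y | 0 < v y} := lt_of_lt_of_le (by positivity) hmem.1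
  have hcd : ContDiffOn ℝ 4 (fun y : ℝ => y ^ ρ) (Ioi 0) := fun y hy =>
    (Real.contDiffAt_rpow_const_of_ne (ne_of_gt hy)).contDiffWithinAt
  have h := norm_iteratedFDerivWithin_comp_le (n := i) (x := x) (C := C) (D := D) hcd
    (hv.contDiff.contDiffOn (s := {y | 0 < v y}))
    (by exact_mod_cast hi) (uniqueDiffOn_Ioi 0) hopen.uniqueDiffOn (fun y hy => hy) hxs
    (fun j hj => hC j (hj.trans hi) _ hmem) ?_
  · rw [iteratedFDerivWithin_of_isOpen i hopen hxs] at h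
    refine h.trans ?_
    have h1 : (Nat.factorial i : ℝ) ≤ Nat.factorial 4 := by
      exact_mod_cast Nat.factorial_le hi
    have h2 : D ^ i ≤ D ^ 4 := pow_le_pow_right₀ hD1 hi
    gcongr
  · intro j hj1 hj
    rw [iteratedFDerivWithin_of_isOpen j hopen hxs]
    have hj4 : (j : ℝ) ≤ 4 := by exact_mod_cast hj.trans hi
    -- This is where 4δ ≤ 1 matters: the exponent is nonnegative, so an upper bound on v suffices.
    have hexp : 0 ≤ 1 - (j : ℝ) * δ := by nlinarith
    have h2r : (1 : ℝ) ≤ 2 ^ r := one_le_pow₀ (by norm_num)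
    have h1 : v x ^ (1 - (j : ℝ) * δ) ≤ 2 ^ r := by
      calc v x ^ (1 - (j : ℝ) * δ) ≤ ((2 : ℝ) ^ r) ^ (1 - (j : ℝ) * δ) :=
            Real.rpow_le_rpow (hv.nonneg x) hmem.2 hexp
        _ ≤ ((2 : ℝ) ^ r) ^ (1 : ℝ) := Real.rpow_le_rpow_of_exponent_le h2r (by
            have : 0 ≤ (j : ℝ) * δ := by positivity
            linarith)
        _ = _ := Real.rpow_one _
    calc ‖iteratedFDeriv ℝ j v x‖ ≤ c * v x ^ (1 - (j : ℝ) * δ) := hv.bound j hj1 (hj.trans hi) x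
      _ ≤ c * 2 ^ r := by gcongr
      _ ≤ D := le_max_right _ _
      _ ≤ D ^ j := le_self_pow₀ hD1 (by omega)

lemma HasPowerBound.contDiffAt_rpow {c δ ρ : ℝ} {v : E → ℝ} (hv : HasPowerBound c δ v) {x : E}
    (hx : 0 < v x) : ContDiffAt ℝ 4 (fun y => v y ^ ρ) x :=
  (Real.contDiffAt_rpow_const_of_ne (x := v x) hx.ne').comp x hv.contDiff.contDiffAt

/-- Second order symmetric Taylor expansion with fourth order remainder. -/
lemma symmetric_taylor_le {h : ℝ → ℝ} {T M : ℝ} (hT : 0 ≤ T)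
    (hcd : ∀ t ∈ Icc (-T) T, ContDiffAt ℝ 4 h t)
    (hM : ∀ t ∈ Icc (-T) T, ‖iteratedDeriv 4 h t‖ ≤ M) :
    h T + h (-T) - 2 * h 0 - T ^ 2 * iteratedDeriv 2 h 0 ≤ M * T ^ 4 := by
  rcases hT.eq_or_lt with rfl | hT
  · simp; linarith
  have hM0 : 0 ≤ M := (norm_nonneg _).trans (hM 0 ⟨by linarith, hT.le⟩)
  -- One-sided cubic expansion, with remainder M T⁴/3!. Applied to h and to its reflection, the
  -- first- and third-order terms cancel in the sum.
  have key : ∀ k : ℝ → ℝ, (∀ t ∈ Icc 0 T, ContDiffAt ℝ 4 k t) →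
      (∀ t ∈ Icc 0 T, ‖iteratedDeriv 4 k t‖ ≤ M) →
      k T - (k 0 + T * deriv k 0 + T ^ 2 / 2 * iteratedDeriv 2 k 0
        + T ^ 3 / 6 * iteratedDeriv 3 k 0) ≤ M * T ^ 4 / 6 := by
    intro k hk hkM
    have hu := uniqueDiffOn_Icc hT
    have h0 : (0 : ℝ) ∈ Icc 0 T := ⟨le_rfl, hT.le⟩
    have hiter : ∀ n : ℕ, n ≤ 4 → ∀ t ∈ Icc 0 T,
        iteratedDerivWithin n k (Icc 0 T) t = iteratedDeriv n k t := fun n hn t ht =>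
      iteratedDerivWithin_eq_iteratedDeriv hu ((hk t ht).of_le (by exact_mod_cast hn)) ht
    have := taylor_mean_remainder_bound (f := k) (a := 0) (b := T) (C := M) (x := T) (n := 3) hT.le
      (fun t ht => (hk t ht).contDiffWithinAt) ⟨hT.le, le_rfl⟩
      (fun y hy => by rw [hiter 4 le_rfl y hy]; exact hkM y hy)
    rw [taylorWithinEval_succ, taylorWithinEval_succ, taylorWithinEval_succ,
      taylor_within_zero_eval] at this
    simp only [zero_add, sub_zero] at this
    rw [hiter 1 (by norm_num) 0 h0, hiter 2 (by norm_num) 0 h0, hiter 3 (by norm_num) 0 h0] at this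
    have h2 := (le_abs_self _).trans this
    norm_num [Nat.factorial] at h2
    linarith
  have h1 := key h (fun t ht => hcd t ⟨by linarith [ht.1], ht.2⟩)
    (fun t ht => hM t ⟨by linarith [ht.1], ht.2⟩)
  have h2 := key (fun t => h (-t))
    (fun t ht => (hcd (-t) ⟨by linarith [ht.2], by linarith [ht.1]⟩).comp t
      contDiff_neg.contDiffAt)
    (fun t ht => by
      rw [iteratedDeriv_comp_neg]
      simpa using hM (-t) ⟨by linarith [ht.2], by linarith [ht.1]⟩)
  simp only [iteratedDeriv_comp_neg] at h2
  norm_num [deriv_comp_neg] at h2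
  have : 0 ≤ M * T ^ 4 := by positivity
  linarith

end LyapunovBound

/-! ### Symmetric differences along parabolas, for functions normalized to 1 at the origin. -/

section Curve

variable {E : Type*} [NormedAddCommGroup E] [NormedSpace ℝ E]

/-- Derivative bounds along the parabola `t ↦ t² α + t β`. -/
lemma norm_iteratedFDeriv_parabola_le {α β : E} {D t : ℝ} (hD : 0 ≤ D) (hα : 2 * ‖α‖ ≤ D ^ 2)
    (hβ : 2 * ‖β‖ ≤ D) (ht : |t| * D ≤ 1 / 2) (i : ℕ) (hi : 1 ≤ i) :
    ‖iteratedFDeriv ℝ i (fun t : ℝ => t ^ 2 • α + t • β) t‖ ≤ D ^ i := by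
  have hd1 : deriv (fun t : ℝ => t ^ 2 • α + t • β) = fun t => (2 * t) • α + β := by
    funext t
    have h1 : HasDerivAt (fun t : ℝ => t ^ 2) (2 * t) t := by simpa using hasDerivAt_pow 2 t
    have h2 : HasDerivAt (fun t : ℝ => t ^ 2 • α + t • β) ((2 * t) • α + (1 : ℝ) • β) t :=
      (h1.smul_const α).add ((hasDerivAt_id t).smul_const β)
    rw [h2.deriv, one_smul]
  have hd2 : deriv (fun t : ℝ => (2 * t) • α + β) = fun _ => (2 : ℝ) • α := by
    funext t
    have h1 : HasDerivAt (fun t : ℝ => 2 * t) 2 t := by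
      simpa using (hasDerivAt_id t).const_mul (2 : ℝ)
    exact ((h1.smul_const α).add_const β).deriv
  rw [norm_iteratedFDeriv_eq_norm_iteratedDeriv]
  match i, hi with
  | 1, _ =>
    rw [iteratedDeriv_one, hd1]
    calc ‖(2 * t) • α + β‖ ≤ ‖(2 * t) • α‖ + ‖β‖ := norm_add_le _ _
      _ = |t| * (2 * ‖α‖) + ‖β‖ := by
        rw [norm_smul, Real.norm_eq_abs, abs_mul, abs_of_pos (by norm_num : (0 : ℝ) < 2)]; ring
      _ ≤ |t| * D ^ 2 + ‖β‖ := by gcongr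
      _ ≤ D ^ 1 := by nlinarith
  | 2, _ =>
    rw [iteratedDeriv_succ', hd1, iteratedDeriv_one, hd2, norm_smul]
    simpa using hα
  | n + 3, _ =>
    rw [iteratedDeriv_succ', hd1, iteratedDeriv_succ', hd2, iteratedDeriv_succ']
    have : deriv (fun _ : ℝ => (2 : ℝ) • α) = fun _ => 0 := by funext; simp
    rw [this, iteratedDeriv_const]
    simp only [ite_self, norm_zero]
    positivity

lemma norm_parabola_le {α β : E} {D t T : ℝ} (hα : 2 * ‖α‖ ≤ D ^ 2)
    (hβ : 2 * ‖β‖ ≤ D) (ht : |t| ≤ T) :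
    ‖t ^ 2 • α + t • β‖ ≤ (D * T) ^ 2 + D * T := by
  have hT : 0 ≤ T := (abs_nonneg t).trans ht
  have hD : 0 ≤ D := by linarith [norm_nonneg β]
  have h2 : t ^ 2 ≤ T ^ 2 := by rw [← sq_abs]; gcongr
  calc ‖t ^ 2 • α + t • β‖ ≤ ‖t ^ 2 • α‖ + ‖t • β‖ := norm_add_le _ _
    _ = t ^ 2 * ‖α‖ + |t| * ‖β‖ := by
      rw [norm_smul, norm_smul, Real.norm_eq_abs, Real.norm_eq_abs, abs_of_nonneg (sq_nonneg t)]
    _ ≤ T ^ 2 * ‖α‖ + T * ‖β‖ := by gcongr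
    _ ≤ T ^ 2 * D ^ 2 + T * D := by
      gcongr <;> linarith [norm_nonneg β, norm_nonneg α]
    _ = _ := by ring

set_option maxHeartbeats 800000 in
/-- The basic one-step estimate: symmetric second differences of `v^ρ` along a parabola are
controlled by the second derivative at `0`, up to a fourth order error. -/
lemma exists_symmetric_difference_le (E : Type*) [NormedAddCommGroup E] [NormedSpace ℝ E]
    (c δ ρ : ℝ) (r : ℕ) (hc : 0 ≤ c) (hδ : 0 < δ) (hδ4 : 4 * δ ≤ 1) (hr : δ * r = 1) (hρ : 0 < ρ) :
    ∃ (C : ℝ) (N : ℕ), 0 ≤ C ∧ ∀ v : E → ℝ, HasPowerBound c δ v → v 0 = 1 →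
      ∀ (α β : E) (T D : ℝ), 0 ≤ T → 0 ≤ D → 2 * ‖α‖ ≤ D ^ 2 → 2 * ‖β‖ ≤ D →
      v (T ^ 2 • α + T • β) ^ ρ + v (T ^ 2 • α - T • β) ^ ρ - 2
          - T ^ 2 * iteratedDeriv 2 (fun t : ℝ => v (t ^ 2 • α + t • β) ^ ρ) 0
        ≤ C * (D * T) ^ 4 * (1 + D * T) ^ N := by
  obtain ⟨M, hM0, hM⟩ := exists_bound_iteratedFDeriv_rpow E c δ ρ r hc hδ hδ4 hr
  obtain ⟨N, hN⟩ := exists_nat_ge (ρ * r)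
  set L : ℝ := 1 + c * δ with hL
  have hcδ : 0 ≤ c * δ := by positivity
  have hL1 : 1 ≤ L := by linarith
  -- Constant for the regime of large x = DT; the small regime contributes 4!·M. In the exponent 2N
  -- + 2, the 2N comes from the growth of v^ρ at points of norm at most x² + x, and the 2 from the
  -- second-derivative term, of size x².
  set C₂ : ℝ := (2 * L ^ N + 2 * M) * (4 * L) ^ 4 with hC₂
  have hC₂0 : 0 ≤ C₂ := by positivity
  refine ⟨24 * M + C₂, 2 * N + 2, by positivity, ?_⟩
  intro v hv h0 α β T D hT hD hα hβ
  set x : ℝ := D * T with hx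
  have hx0 : 0 ≤ x := mul_nonneg hD hT
  set h : ℝ → ℝ := fun t => v (t ^ 2 • α + t • β) ^ ρ with hh
  have hhT : h T = v (T ^ 2 • α + T • β) ^ ρ := rfl
  have hhT' : h (-T) = v (T ^ 2 • α - T • β) ^ ρ := by
    simp only [hh, even_two.neg_pow, neg_smul, sub_eq_add_neg]
  have hh0 : h 0 = 1 := by simp [hh, h0]
  -- local regularity
  have hreg : ∀ t S : ℝ, |t| ≤ S → D * S * L ≤ 1 / 4 → ContDiffAt ℝ 4 h t ∧
      ∀ i : ℕ, i ≤ 4 → ‖iteratedDeriv i h t‖ ≤ Nat.factorial i * M * D ^ i := by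
    intro t S ht hS
    have hS0 : 0 ≤ S := (abs_nonneg t).trans ht
    have hDS : 0 ≤ D * S := mul_nonneg hD hS0
    have hDS4 : D * S ≤ 1 / 4 := by nlinarith
    have hnorm := norm_parabola_le hα hβ ht
    have hsm : c * δ * ‖t ^ 2 • α + t • β‖ ≤ 1 / 2 := by
      calc c * δ * ‖t ^ 2 • α + t • β‖ ≤ L * ((D * S) ^ 2 + D * S) := by gcongr; linarith
        _ ≤ 1 / 2 := by nlinarith
    have hpos : 0 < v (t ^ 2 • α + t • β) :=
      lt_of_lt_of_le (by positivity) (hv.mem_Icc hc hδ (by linarith) hr h0 hsm).1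
    have hγ : ContDiff ℝ 4 (fun t : ℝ => t ^ 2 • α + t • β) := by fun_prop
    have hop : IsOpen {y | 0 < v y} := isOpen_lt continuous_const hv.contDiff.continuous
    have hop' : IsOpen {t : ℝ | 0 < v (t ^ 2 • α + t • β)} := hop.preimage hγ.continuous
    refine ⟨ContDiffAt.comp t (g := fun y => v y ^ ρ) (f := fun t : ℝ => t ^ 2 • α + t • β)
      (hv.contDiffAt_rpow hpos) hγ.contDiffAt, fun i hi => ?_⟩
    rw [← norm_iteratedFDeriv_eq_norm_iteratedDeriv, ← iteratedFDerivWithin_of_isOpen i hop' hpos]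
    refine norm_iteratedFDerivWithin_comp_le (N := 4) (g := fun y => v y ^ ρ)
      (t := {y | 0 < v y}) (f := fun t : ℝ => t ^ 2 • α + t • β)
      (fun y hy => (hv.contDiffAt_rpow hy).contDiffWithinAt) hγ.contDiffOn (by exact_mod_cast hi)
      hop.uniqueDiffOn hop'.uniqueDiffOn (fun y hy => hy) hpos ?_ ?_
    · intro j hj
      rw [iteratedFDerivWithin_of_isOpen j hop hpos]
      exact hM v hv h0 _ hsm j (hj.trans hi)
    · intro j hj1 hj
      rw [iteratedFDerivWithin_of_isOpen j hop' hpos]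
      refine norm_iteratedFDeriv_parabola_le hD hα hβ ?_ j hj1
      nlinarith
  have hx1 : 1 ≤ 1 + x := by linarith
  have hpow1 : 1 ≤ (1 + x) ^ (2 * N + 2) := one_le_pow₀ (by linarith)
  rw [← hhT, ← hhT']
  -- For small x the whole arc stays where v is bounded below and Taylor applies. Otherwise 1 ≤
  -- (4L)⁴x⁴, so a crude growth bound already has the required fourth-order form.
  by_cases hsmall : x * L ≤ 1 / 4
  · have := symmetric_taylor_le hT (h := h) (M := 24 * M * D ^ 4)
      (fun t ht => (hreg t T (abs_le.2 ht) hsmall).1)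
      (fun t ht => by
        have := (hreg t T (abs_le.2 ht) hsmall).2 4 le_rfl
        norm_num [Nat.factorial] at this ⊢
        exact this)
    rw [hh0] at this
    calc _ ≤ 24 * M * D ^ 4 * T ^ 4 := by linarith
      _ = 24 * M * x ^ 4 := by rw [hx]; ring
      _ ≤ (24 * M + C₂) * x ^ 4 * 1 := by nlinarith [pow_nonneg hx0 4]
      _ ≤ _ := by gcongr
  · push Not at hsmall
    have hbig : 1 ≤ (4 * L) ^ 4 * x ^ 4 := by
      rw [← mul_pow]; exact one_le_pow₀ (by linarith)
    have hgrow : ∀ y : E, ‖y‖ ≤ x ^ 2 + x → v y ^ ρ ≤ L ^ N * (1 + x) ^ (2 * N + 2) := by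
      intro y hy
      calc v y ^ ρ ≤ (1 + c * δ * ‖y‖) ^ N :=
            hv.rpow_le hc hδ (by linarith) hr hρ hN h0 y
        _ ≤ (L * (1 + x) ^ 2) ^ N := by
            refine pow_le_pow_left₀ (by positivity) ?_ N
            calc 1 + c * δ * ‖y‖ ≤ 1 + c * δ * (x ^ 2 + x) := by gcongr
              _ ≤ L * (1 + x) ^ 2 := by rw [hL]; nlinarith [mul_nonneg hcδ hx0]
        _ = L ^ N * (1 + x) ^ (2 * N) := by rw [mul_pow, ← pow_mul]
        _ ≤ _ := mul_le_mul_of_nonneg_left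
            (pow_le_pow_right₀ hx1 (by omega)) (by positivity)
    have h1 : h T ≤ L ^ N * (1 + x) ^ (2 * N + 2) :=
      hgrow _ (norm_parabola_le hα hβ (abs_of_nonneg hT).le)
    have h2 : h (-T) ≤ L ^ N * (1 + x) ^ (2 * N + 2) :=
      hgrow _ (norm_parabola_le hα hβ (by rw [abs_neg, abs_of_nonneg hT]))
    have h3 : -(T ^ 2 * iteratedDeriv 2 h 0) ≤ 2 * M * (1 + x) ^ (2 * N + 2) := by
      -- At t = 0 the radius S = 0 is allowed, so the derivative bound needs no smallness of x.
      have h4 := (hreg 0 0 (by simp) (by simp)).2 2 (by norm_num)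
      rw [Real.norm_eq_abs] at h4
      have h5 := (neg_le_abs (iteratedDeriv 2 h 0)).trans h4
      norm_num [Nat.factorial] at h5
      calc -(T ^ 2 * iteratedDeriv 2 h 0) = T ^ 2 * -(iteratedDeriv 2 h 0) := by ring
        _ ≤ T ^ 2 * (2 * M * D ^ 2) := by gcongr
        _ = 2 * M * x ^ 2 := by rw [hx]; ring
        _ ≤ 2 * M * (1 + x) ^ 2 := by gcongr; linarith
        _ ≤ _ := mul_le_mul_of_nonneg_left
            (pow_le_pow_right₀ hx1 (by omega)) (by positivity)
    calc _ ≤ (2 * L ^ N + 2 * M) * (1 + x) ^ (2 * N + 2) := by linarith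
      _ = (2 * L ^ N + 2 * M) * 1 * (1 + x) ^ (2 * N + 2) := by ring
      _ ≤ (2 * L ^ N + 2 * M) * ((4 * L) ^ 4 * x ^ 4) * (1 + x) ^ (2 * N + 2) := by gcongr
      _ = C₂ * x ^ 4 * (1 + x) ^ (2 * N + 2) := by rw [hC₂, mul_assoc _ ((4 * L) ^ 4)]
      _ ≤ _ := by
        refine mul_le_mul_of_nonneg_right (mul_le_mul_of_nonneg_right ?_ ?_) ?_ <;>
          first | positivity | linarith

end Curve

/-! ### Rescaling around a point, and the derivative along a parabola. -/

section Normalization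

variable {E : Type*} [NormedAddCommGroup E] [NormedSpace ℝ E]

/-- The class is invariant under the natural rescaling around a point. -/
lemma HasPowerBound.rescale {c δ : ℝ} {V : E → ℝ} (hV : HasPowerBound c δ V) {z : E}
    (hz : 0 < V z) : HasPowerBound c δ (fun η => V (z + V z ^ δ • η) / V z) := by
  set s : ℝ := V z ^ δ with hs
  have hs0 : 0 < s := Real.rpow_pos_of_pos hz _
  have hcd : ContDiff ℝ 4 fun y => V (z + y) := hV.contDiff.comp (contDiff_const.add contDiff_id)
  have hcd' : ContDiff ℝ 4 ((fun y => V (z + y)) ∘ (s • ContinuousLinearMap.id ℝ E)) :=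
    hcd.comp (ContinuousLinearMap.contDiff _)
  have hfun : (fun η => V (z + s • η) / V z)
      = fun η => (V z)⁻¹ • ((fun y => V (z + y)) ∘ (s • ContinuousLinearMap.id ℝ E)) η := by
    funext η; simp [div_eq_inv_mul]
  refine ⟨?_, fun x => div_nonneg (hV.nonneg _) hz.le, ?_⟩
  · rw [hfun]; exact hcd'.const_smul _
  · intro n hn1 hn4 x
    have hn4' : (n : WithTop ℕ∞) ≤ 4 := by exact_mod_cast hn4
    rw [hfun, iteratedFDeriv_const_smul_apply' (hcd'.contDiffAt.of_le hn4'), norm_smul,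
      ContinuousLinearMap.iteratedFDeriv_comp_right _ hcd x hn4']
    have h1 := ContinuousMultilinearMap.norm_compContinuousLinearMap_le
      (iteratedFDeriv ℝ n (fun y => V (z + y)) ((s • ContinuousLinearMap.id ℝ E) x))
      (fun _ => s • ContinuousLinearMap.id ℝ E)
    have h2 : ‖s • ContinuousLinearMap.id ℝ E‖ ≤ s := by
      rw [norm_smul, Real.norm_of_nonneg hs0.le]
      exact mul_le_of_le_one_right hs0.le ContinuousLinearMap.norm_id_le
    rw [Finset.prod_const, Finset.card_univ, Fintype.card_fin] at h1
    rw [iteratedFDeriv_comp_add_left] at h1 ⊢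
    have h3 := hV.bound n hn1 hn4 (z + (s • ContinuousLinearMap.id ℝ E) x)
    have hx : z + (s • ContinuousLinearMap.id ℝ E) x = z + s • x := by simp
    rw [hx] at h1 h3 ⊢
    have hc := hV.const_nonneg hz
    -- The scale s = V(z)^δ is chosen for this identity: the chain-rule factor sⁿ and the division
    -- by V(z) leave exactly the power needed to keep the constant c.
    have hVz : V z = V z ^ (1 - (n : ℝ) * δ) * s ^ n := by
      rw [hs, ← Real.rpow_mul_natCast hz.le, ← Real.rpow_add hz]
      ring_nf; simp
    have h5 : (V z)⁻¹ * s ^ n = (V z ^ (1 - (n : ℝ) * δ))⁻¹ := by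
      refine eq_inv_of_mul_eq_one_left ?_
      rw [mul_assoc, mul_comm (s ^ n), ← hVz, inv_mul_cancel₀ hz.ne']
    rw [Real.norm_of_nonneg (inv_nonneg.2 hz.le)]
    calc (V z)⁻¹ * _ ≤ (V z)⁻¹ * (c * V (z + s • x) ^ (1 - (n : ℝ) * δ) * s ^ n) := by
          have := hV.nonneg (z + s • x)
          refine mul_le_mul_of_nonneg_left (h1.trans ?_) (by positivity)
          gcongr
      _ = c * (V (z + s • x) ^ (1 - (n : ℝ) * δ) * ((V z)⁻¹ * s ^ n)) := by ring
      _ = c * (V (z + s • x) / V z) ^ (1 - (n : ℝ) * δ) := by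
          rw [h5, Real.div_rpow (hV.nonneg _) hz.le, div_eq_mul_inv]
      _ = _ := by simp [div_eq_inv_mul]

/-- Second derivative at `0` of a `C²` function along a parabola. -/
lemma iteratedDeriv_two_parabola {U : E → ℝ} {z : E} (hU : ContDiffAt ℝ 2 U z) (a b : E) :
    iteratedDeriv 2 (fun t : ℝ => U (z + (t ^ 2 • a + t • b))) 0
      = 2 * fderiv ℝ U z a + iteratedFDeriv ℝ 2 U z ![b, b] := by
  set γ : ℝ → E := fun t => z + (t ^ 2 • a + t • b) with hγ
  have hγ0 : γ 0 = z := by simp [hγ]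
  have hγd : ∀ t, HasDerivAt γ ((2 * t) • a + b) t := by
    intro t
    have h1 : HasDerivAt (fun t : ℝ => t ^ 2) (2 * t) t := by simpa using hasDerivAt_pow 2 t
    have h2 : HasDerivAt (fun t : ℝ => t ^ 2 • a + t • b) ((2 * t) • a + (1 : ℝ) • b) t :=
      (h1.smul_const a).add ((hasDerivAt_id t).smul_const b)
    rw [one_smul] at h2
    exact h2.const_add z
  have hγc : Tendsto γ (𝓝 0) (𝓝 z) := by
    have := (hγd 0).continuousAt.tendsto
    rwa [hγ0] at this
  have hev : deriv (fun t => U (γ t)) =ᶠ[𝓝 0] fun t => fderiv ℝ U (γ t) ((2 * t) • a + b) := by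
    have hdiff : ∀ᶠ y in 𝓝 z, DifferentiableAt ℝ U y := by
      filter_upwards [hU.eventually (by simp)] with y hy using hy.differentiableAt (by norm_num)
    filter_upwards [hγc.eventually hdiff] with t ht
    exact (ht.hasFDerivAt.comp_hasDerivAt t (hγd t)).deriv
  have hd2 : HasFDerivAt (fderiv ℝ U) (fderiv ℝ (fderiv ℝ U) (γ 0)) (γ 0) := by
    rw [hγ0]
    exact ((hU.fderiv_right (m := 1) (by norm_num)).differentiableAt (by norm_num)).hasFDerivAt
  have h3 := hd2.comp_hasDerivAt (0 : ℝ) (hγd 0)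
  have h4 : HasDerivAt (fun t : ℝ => (2 * t) • a + b) ((2 : ℝ) • a) 0 := by
    have h1 : HasDerivAt (fun t : ℝ => 2 * t) 2 0 := by
      simpa using (hasDerivAt_id (0 : ℝ)).const_mul (2 : ℝ)
    exact (h1.smul_const a).add_const b
  have h5 := h3.clm_apply h4
  rw [iteratedDeriv_succ, iteratedDeriv_one, hev.deriv_eq]
  refine h5.deriv.trans ?_
  simp only [Function.comp_apply, hγ0, mul_zero, zero_smul, zero_add, map_smul, smul_eq_mul,
    iteratedFDeriv_two_apply, Matrix.cons_val_zero, Matrix.cons_val_one]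
  ring

/-- The normalized estimate, applied to the rescaling of V at z and multiplied back by V(z)^ρ.
Displacements are measured in units of V(z)^δ, which makes C and N independent of z. -/
lemma exists_symmetric_step_le (c δ ρ : ℝ) (r : ℕ) (hc : 0 ≤ c)
    (hδ : 0 < δ) (hδ4 : 4 * δ ≤ 1) (hr : δ * r = 1) (hρ : 0 < ρ) {V : E → ℝ}
    (hV : HasPowerBound c δ V) :
    ∃ (C : ℝ) (N : ℕ), 0 ≤ C ∧ ∀ z, 0 < V z → ∀ (a b : E) (T D : ℝ), 0 ≤ T → 0 ≤ D →
      2 * ‖a‖ ≤ D ^ 2 * V z ^ δ → 2 * ‖b‖ ≤ D * V z ^ δ →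
      V (z + (T ^ 2 • a + T • b)) ^ ρ + V (z + (T ^ 2 • a - T • b)) ^ ρ
        ≤ V z ^ ρ * (2 + C * ((D * T) ^ 4 * (1 + D * T) ^ N))
          + T ^ 2 * (2 * fderiv ℝ (fun y => V y ^ ρ) z a
            + iteratedFDeriv ℝ 2 (fun y => V y ^ ρ) z ![b, b]) := by
  obtain ⟨C, N, hC, h⟩ := exists_symmetric_difference_le E c δ ρ r hc hδ hδ4 hr hρ
  refine ⟨C, N, hC, ?_⟩
  intro z hz a b T D hT hD ha hb
  set s : ℝ := V z ^ δ with hs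
  have hs0 : 0 < s := Real.rpow_pos_of_pos hz _
  have hVρ : 0 < V z ^ ρ := Real.rpow_pos_of_pos hz _
  have hcancel : ∀ x : E, s • s⁻¹ • x = x := fun x => smul_inv_smul₀ hs0.ne' x
  have hn : ∀ x : E, ‖s⁻¹ • x‖ = ‖x‖ / s := fun x => by
    rw [norm_smul, Real.norm_of_nonneg (inv_nonneg.2 hs0.le), div_eq_inv_mul]
  have h1 := h _ (hV.rescale hz) (by simp [hz.ne']) (s⁻¹ • a) (s⁻¹ • b) T D hT hD
    (by rw [hn, ← mul_div_assoc, div_le_iff₀ hs0]; exact ha)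
    (by rw [hn, ← mul_div_assoc, div_le_iff₀ hs0]; exact hb)
  have hpt : ∀ t : ℝ, s • (t ^ 2 • s⁻¹ • a + t • s⁻¹ • b) = t ^ 2 • a + t • b := fun t => by
    rw [smul_add, smul_comm s (t ^ 2), smul_comm s t, hcancel, hcancel]
  have hpt' : s • (T ^ 2 • s⁻¹ • a - T • s⁻¹ • b) = T ^ 2 • a - T • b := by
    rw [smul_sub, smul_comm s (T ^ 2), smul_comm s T, hcancel, hcancel]
  have hdiv : ∀ y, (V y / V z) ^ ρ = (V z ^ ρ)⁻¹ * V y ^ ρ := fun y => by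
    rw [Real.div_rpow (hV.nonneg _) hz.le, div_eq_inv_mul]
  simp only [← hs, hpt, hpt', hdiv] at h1
  have hU := (hV.contDiffAt_rpow (ρ := ρ) hz).of_le (m := 2) (by norm_num)
  have hd : iteratedDeriv 2 (fun t : ℝ => (V z ^ ρ)⁻¹ * V (z + (t ^ 2 • a + t • b)) ^ ρ) 0
      = (V z ^ ρ)⁻¹ * (2 * fderiv ℝ (fun y => V y ^ ρ) z a
            + iteratedFDeriv ℝ 2 (fun y => V y ^ ρ) z ![b, b]) := by
    rw [← iteratedDeriv_two_parabola hU]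
    simp [iteratedDeriv_succ]
  rw [hd] at h1
  set Q := 2 * fderiv ℝ (fun y => V y ^ ρ) z a + iteratedFDeriv ℝ 2 (fun y => V y ^ ρ) z ![b, b]
  have h2 := mul_le_mul_of_nonneg_left h1 hVρ.le
  have h3 : ∀ y, V z ^ ρ * ((V z ^ ρ)⁻¹ * y) = y := fun y => mul_inv_cancel_left₀ hVρ.ne' y
  have h4 : V z ^ ρ * (T ^ 2 * ((V z ^ ρ)⁻¹ * Q)) = T ^ 2 * Q := by rw [mul_left_comm, h3]
  rw [mul_sub, mul_sub, mul_add, h3, h3, h4] at h2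
  linarith

end Normalization

/-! ### Passing between partial derivatives and multilinear derivatives. -/

section Coordinates

variable {d m : ℕ}

lemma abs_partialDeriv_le_derivNorm (n : ℕ) (U : EuclideanSpace ℝ (Fin d) → ℝ)
    (ι : Fin n → Fin d) (x : EuclideanSpace ℝ (Fin d)) :
    |partialDeriv n U ι x| ≤ derivNorm n U x := by
  rw [← Real.sqrt_sq_eq_abs]
  exact Real.sqrt_le_sqrt (Finset.single_le_sum (f := fun ι => partialDeriv n U ι x ^ 2)
    (fun _ _ => sq_nonneg _) (Finset.mem_univ ι))

lemma sum_smul_euclideanSpace_single (x : EuclideanSpace ℝ (Fin d)) :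
    ∑ i, x i • EuclideanSpace.single i (1 : ℝ) = x := by
  have := (EuclideanSpace.basisFun (Fin d) ℝ).sum_repr x
  simpa using this

lemma iteratedFDeriv_apply_eq_sum (n : ℕ) (U : EuclideanSpace ℝ (Fin d) → ℝ)
    (x : EuclideanSpace ℝ (Fin d)) (y : Fin n → EuclideanSpace ℝ (Fin d)) :
    iteratedFDeriv ℝ n U x y = ∑ ι : Fin n → Fin d, (∏ k, y k (ι k)) * partialDeriv n U ι x := by
  have hy : y = fun k => ∑ i, y k i • EuclideanSpace.single i (1 : ℝ) := by
    funext k; exact (sum_smul_euclideanSpace_single _).symm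
  conv_lhs => rw [hy]
  rw [ContinuousMultilinearMap.map_sum]
  refine Finset.sum_congr rfl fun ι _ => ?_
  rw [ContinuousMultilinearMap.map_smul_univ, smul_eq_mul]
  rfl

/-- The operator norm of the `n`-th derivative is controlled by the Euclidean norm of the family
of partial derivatives. -/
lemma norm_iteratedFDeriv_le_derivNorm (n : ℕ) (U : EuclideanSpace ℝ (Fin d) → ℝ)
    (x : EuclideanSpace ℝ (Fin d)) :
    ‖iteratedFDeriv ℝ n U x‖ ≤ (d : ℝ) ^ n * derivNorm n U x := by
  have hdn : 0 ≤ derivNorm n U x := Real.sqrt_nonneg _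
  refine ContinuousMultilinearMap.opNorm_le_bound (by positivity) fun y => ?_
  rw [iteratedFDeriv_apply_eq_sum]
  calc ‖∑ ι : Fin n → Fin d, (∏ k, y k (ι k)) * partialDeriv n U ι x‖
      ≤ ∑ ι : Fin n → Fin d, ‖(∏ k, y k (ι k)) * partialDeriv n U ι x‖ := norm_sum_le _ _
    _ ≤ ∑ _ι : Fin n → Fin d, (∏ k, ‖y k‖) * derivNorm n U x := by
        refine Finset.sum_le_sum fun ι _ => ?_
        rw [norm_mul, norm_prod]
        refine mul_le_mul (Finset.prod_le_prod (fun _ _ => norm_nonneg _) fun k _ => ?_)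
          (abs_partialDeriv_le_derivNorm n U ι x) (abs_nonneg _)
          (Finset.prod_nonneg fun _ _ => norm_nonneg _)
        exact PiLp.norm_apply_le (y k) (ι k)
    _ = (d : ℝ) ^ n * derivNorm n U x * ∏ k, ‖y k‖ := by
        rw [Finset.sum_const, Finset.card_univ, Fintype.card_fun, Fintype.card_fin,
          Fintype.card_fin, nsmul_eq_mul]
        push_cast; ring

lemma IsLyapunovClass.exists_hasPowerBound {δ : ℝ} {V : EuclideanSpace ℝ (Fin d) → ℝ}
    (hd : 0 < d) (hV : IsLyapunovClass 4 δ V) : ∃ c : ℝ, 0 ≤ c ∧ HasPowerBound c δ V := by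
  obtain ⟨c, hc, h⟩ := hV.deriv_le
  have hd1 : (1 : ℝ) ≤ d := by exact_mod_cast hd
  refine ⟨(d : ℝ) ^ 4 * c, by positivity, hV.contDiff, hV.nonneg, ?_⟩
  intro n hn1 hn4 x
  have h1 : 0 ≤ c * V x ^ (1 - (n : ℝ) * δ) :=
    mul_nonneg hc.le (Real.rpow_nonneg (hV.nonneg x) _)
  calc ‖iteratedFDeriv ℝ n V x‖ ≤ (d : ℝ) ^ n * derivNorm n V x :=
        norm_iteratedFDeriv_le_derivNorm n V x
    _ ≤ (d : ℝ) ^ n * (c * V x ^ (1 - (n : ℝ) * δ)) := by gcongr; exact h n hn1 hn4 x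
    _ ≤ (d : ℝ) ^ 4 * (c * V x ^ (1 - (n : ℝ) * δ)) :=
        mul_le_mul_of_nonneg_right (pow_le_pow_right₀ hd1 hn4) h1
    _ = _ := by ring

lemma fderiv_apply_eq_sum (U : EuclideanSpace ℝ (Fin d) → ℝ) (x a : EuclideanSpace ℝ (Fin d)) :
    fderiv ℝ U x a = ∑ i : Fin d, partialDeriv 1 U ![i] x * a i := by
  conv_lhs => rw [← sum_smul_euclideanSpace_single a]
  rw [map_sum]
  refine Finset.sum_congr rfl fun i _ => ?_
  rw [map_smul, smul_eq_mul, mul_comm, partialDeriv, iteratedFDeriv_one_apply]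
  simp

lemma iteratedFDeriv_two_apply_eq_sum (U : EuclideanSpace ℝ (Fin d) → ℝ)
    (x b : EuclideanSpace ℝ (Fin d)) :
    iteratedFDeriv ℝ 2 U x ![b, b]
      = ∑ i : Fin d, ∑ j : Fin d, partialDeriv 2 U ![i, j] x * (b i * b j) := by
  rw [iteratedFDeriv_two_apply]
  simp only [Matrix.cons_val_zero, Matrix.cons_val_one]
  conv_lhs => rw [← sum_smul_euclideanSpace_single b]
  simp only [map_sum, map_smul, _root_.sum_apply, _root_.smul_apply,
    smul_eq_mul, Finset.mul_sum]
  rw [Finset.sum_comm]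
  refine Finset.sum_congr rfl fun i _ => Finset.sum_congr rfl fun j _ => ?_
  rw [partialDeriv, iteratedFDeriv_two_apply]
  simp
  ring

lemma traceNorm_sq (A : Matrix (Fin d) (Fin m) ℝ) :
    traceNorm A ^ 2 = ∑ i, ∑ j, A i j ^ 2 := by
  have h : (Aᵀ * A).trace = ∑ i, ∑ j, A i j ^ 2 := by
    simp only [Matrix.trace, Matrix.diag, Matrix.mul_apply, Matrix.transpose_apply]
    rw [Finset.sum_comm]
    simp [sq]
  rw [traceNorm, Real.sq_sqrt, h]
  rw [h]
  positivity

lemma norm_toLp_mulVec_le (A : Matrix (Fin d) (Fin m) ℝ) (ξ : EuclideanSpace ℝ (Fin m)) :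
    ‖WithLp.toLp 2 (A *ᵥ ξ.ofLp)‖ ≤ traceNorm A * ‖ξ‖ := by
  have hA : 0 ≤ traceNorm A := Real.sqrt_nonneg _
  refine (sq_le_sq₀ (norm_nonneg _) (by positivity)).1 ?_
  rw [mul_pow, traceNorm_sq, EuclideanSpace.real_norm_sq_eq, EuclideanSpace.real_norm_sq_eq,
    Finset.sum_mul]
  refine Finset.sum_le_sum fun i _ => ?_
  exact Finset.sum_mul_sq_le_sq_mul_sq Finset.univ (A i) ξ.ofLp

end Coordinates

/-! ### Gaussian moments and the averaged one-step estimate. -/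

section Gaussian

variable {d m : ℕ}

/-- The base 3 + 2‖ξ‖ dominates the factor 1 + D√Δ of the step remainder once AΔ ≤ 1. -/
lemma integrable_polynomial_norm_stdGaussian (n : ℕ) :
    Integrable (fun ξ : EuclideanSpace ℝ (Fin m) => (3 + 2 * ‖ξ‖) ^ n)
      (stdGaussian (EuclideanSpace ℝ (Fin m))) := by
  have h1 : MemLp (fun ξ : EuclideanSpace ℝ (Fin m) => 3 + 2 * ‖ξ‖) n
      (stdGaussian (EuclideanSpace ℝ (Fin m))) :=
    (memLp_const (3 : ℝ)).add
      (((IsGaussian.memLp_id _ (n : ℝ≥0∞) (ENNReal.natCast_ne_top n)).norm).const_mul 2)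
  refine h1.integrable_norm_pow'.congr (ae_of_all _ fun ξ => ?_)
  have : 0 ≤ 3 + 2 * ‖ξ‖ := by positivity
  simp only [Real.norm_of_nonneg this]

lemma memLp_coord_stdGaussian (i : Fin m) :
    MemLp (fun ξ : EuclideanSpace ℝ (Fin m) => ξ i) 2
      (stdGaussian (EuclideanSpace ℝ (Fin m))) := by
  refine (IsGaussian.memLp_two_id (μ := stdGaussian (EuclideanSpace ℝ (Fin m)))).mono
    (by fun_prop) (ae_of_all _ fun ξ => PiLp.norm_apply_le ξ i)

lemma integrable_coord_mul_coord_stdGaussian (i j : Fin m) :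
    Integrable (fun ξ : EuclideanSpace ℝ (Fin m) => ξ i * ξ j)
      (stdGaussian (EuclideanSpace ℝ (Fin m))) :=
  (memLp_coord_stdGaussian i).integrable_mul (memLp_coord_stdGaussian j)

lemma integral_coord_mul_coord_stdGaussian (i j : Fin m) :
    ∫ ξ : EuclideanSpace ℝ (Fin m), ξ i * ξ j ∂(stdGaussian (EuclideanSpace ℝ (Fin m)))
      = (1 : Matrix (Fin m) (Fin m) ℝ) i j := by
  have h := covariance_eval_multivariateGaussian (μ := (0 : EuclideanSpace ℝ (Fin m)))
    (S := (1 : Matrix (Fin m) (Fin m) ℝ)) Matrix.PosSemidef.one i j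
  rw [multivariateGaussian_zero_one,
    covariance_eq_sub (memLp_coord_stdGaussian i) (memLp_coord_stdGaussian j)] at h
  have h0 : ∫ ξ : EuclideanSpace ℝ (Fin m), ξ i ∂(stdGaussian (EuclideanSpace ℝ (Fin m))) = 0 :=
    integral_strongDual_stdGaussian (EuclideanSpace.proj i : EuclideanSpace ℝ (Fin m) →L[ℝ] ℝ)
  rw [h0, zero_mul, sub_zero] at h
  exact h

/-- Reflection is a linear isometry, and these preserve the standard Gaussian. This licenses
averaging over ξ and -ξ. -/
lemma lintegral_comp_neg_stdGaussian (F : EuclideanSpace ℝ (Fin m) → ℝ≥0∞) (hF : Measurable F) :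
    ∫⁻ ξ, F (-ξ) ∂(stdGaussian (EuclideanSpace ℝ (Fin m)))
      = ∫⁻ ξ, F ξ ∂(stdGaussian (EuclideanSpace ℝ (Fin m))) := by
  have h := stdGaussian_map (LinearIsometryEquiv.neg ℝ (E := EuclideanSpace ℝ (Fin m)))
  conv_rhs => rw [← h]
  rw [lintegral_map hF (by fun_prop)]
  rfl

/-- The Gaussian expectation of a quadratic form in `Gξ`. -/
lemma integral_quadratic_stdGaussian (G : Matrix (Fin d) (Fin m) ℝ) (H : Matrix (Fin d) (Fin d) ℝ) :
    Integrable (fun ξ : EuclideanSpace ℝ (Fin m) =>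
        ∑ i, ∑ j, H i j * ((G *ᵥ ξ.ofLp) i * (G *ᵥ ξ.ofLp) j))
      (stdGaussian (EuclideanSpace ℝ (Fin m))) ∧
    ∫ ξ : EuclideanSpace ℝ (Fin m), ∑ i, ∑ j, H i j * ((G *ᵥ ξ.ofLp) i * (G *ᵥ ξ.ofLp) j)
      ∂(stdGaussian (EuclideanSpace ℝ (Fin m))) = (Gᵀ * H * G).trace := by
  have hexp : ∀ (i j : Fin d) (ξ : EuclideanSpace ℝ (Fin m)),
      H i j * ((G *ᵥ ξ.ofLp) i * (G *ᵥ ξ.ofLp) j)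
        = ∑ k, ∑ l, (H i j * G i k * G j l) * (ξ k * ξ l) := by
    intro i j ξ
    simp only [Matrix.mulVec, dotProduct]
    rw [Finset.sum_mul_sum]
    simp only [Finset.mul_sum]
    refine Finset.sum_congr rfl fun k _ => Finset.sum_congr rfl fun l _ => ?_
    ring
  have hint : ∀ (i j : Fin d) (k l : Fin m), Integrable (fun ξ : EuclideanSpace ℝ (Fin m) =>
      (H i j * G i k * G j l) * (ξ k * ξ l)) (stdGaussian (EuclideanSpace ℝ (Fin m))) :=
    fun i j k l => (integrable_coord_mul_coord_stdGaussian k l).const_mul _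
  simp only [hexp]
  refine ⟨integrable_finsetSum _ fun i _ => integrable_finsetSum _ fun j _ =>
    integrable_finsetSum _ fun k _ => integrable_finsetSum _ fun l _ => hint i j k l, ?_⟩
  rw [integral_finsetSum _ fun i _ => integrable_finsetSum _ fun j _ =>
    integrable_finsetSum _ fun k _ => integrable_finsetSum _ fun l _ => hint i j k l]
  have h1 : ∀ i, ∫ ξ : EuclideanSpace ℝ (Fin m),
      ∑ j, ∑ k, ∑ l, (H i j * G i k * G j l) * (ξ k * ξ l)
        ∂(stdGaussian (EuclideanSpace ℝ (Fin m))) = ∑ j, ∑ k, H i j * G i k * G j k := by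
    intro i
    rw [integral_finsetSum _ fun j _ => integrable_finsetSum _ fun k _ =>
      integrable_finsetSum _ fun l _ => hint i j k l]
    refine Finset.sum_congr rfl fun j _ => ?_
    rw [integral_finsetSum _ fun k _ => integrable_finsetSum _ fun l _ => hint i j k l]
    refine Finset.sum_congr rfl fun k _ => ?_
    rw [integral_finsetSum _ fun l _ => hint i j k l]
    simp only [integral_const_mul, integral_coord_mul_coord_stdGaussian]
    simp [Matrix.one_apply]
  simp only [h1]
  simp only [Matrix.trace, Matrix.diag, Matrix.mul_apply, Matrix.transpose_apply, Finset.sum_mul]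
  rw [Finset.sum_comm, Finset.sum_congr rfl fun j _ => Finset.sum_comm, Finset.sum_comm]
  refine Finset.sum_congr rfl fun k _ => Finset.sum_congr rfl fun j _ =>
    Finset.sum_congr rfl fun i _ => ?_
  ring

/-- One-step estimate for the untruncated Euler–Maruyama step. -/
lemma exists_lintegral_step_le (hd : 0 < d) {δ ρ : ℝ} {r : ℕ} (hδ : 0 < δ) (hδ4 : 4 * δ ≤ 1)
    (hr : δ * r = 1) (hρ : 0 < ρ) {V : EuclideanSpace ℝ (Fin d) → ℝ} (hV : IsLyapunovClass 4 δ V) :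
    ∃ C : ℝ, 0 ≤ C ∧ ∀ z, 0 < V z → ∀ (a : EuclideanSpace ℝ (Fin d))
      (G : Matrix (Fin d) (Fin m) ℝ) (A Δ : ℝ), 0 ≤ A → 0 ≤ Δ → A * Δ ≤ 1 → ‖a‖ ≤ A * V z ^ δ →
      traceNorm G ^ 2 ≤ A * V z ^ (2 * δ) →
      ∫⁻ ξ : EuclideanSpace ℝ (Fin m),
          ENNReal.ofReal (V (z + Δ • a + WithLp.toLp 2 (G *ᵥ (√Δ • ξ).ofLp)) ^ ρ)
          ∂(stdGaussian (EuclideanSpace ℝ (Fin m)))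
        ≤ ENNReal.ofReal (V z ^ ρ * (1 + C * (A * Δ) ^ 2) + Δ *
          ((∑ i : Fin d, partialDeriv 1 (fun y => V y ^ ρ) ![i] z * a i) + (1 / 2) *
            (Gᵀ * (Matrix.of fun i j : Fin d => partialDeriv 2 (fun y => V y ^ ρ) ![i, j] z)
              * G).trace)) := by
  obtain ⟨c, hc, hVc⟩ := hV.exists_hasPowerBound hd
  obtain ⟨C, N, hC, h⟩ := exists_symmetric_step_le c δ ρ r hc hδ hδ4 hr hρ hVc
  set ν := stdGaussian (EuclideanSpace ℝ (Fin m)) with hν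
  set I : ℝ := ∫ ξ : EuclideanSpace ℝ (Fin m), (3 + 2 * ‖ξ‖) ^ (N + 4) ∂ν with hI
  have hI0 : 0 ≤ I := integral_nonneg fun ξ => by positivity
  -- The remainder contains (D√Δ)⁴ = 16(AΔ)²(1 + ‖ξ‖)⁴; averaging the two signs halves 16 to 8. The
  -- moment I absorbs this fourth power together with the N-th power of 1 + D√Δ.
  refine ⟨8 * C * I, by positivity, ?_⟩
  intro z hz a G A Δ hA hΔ hAΔ ha hG
  set U : EuclideanSpace ℝ (Fin d) → ℝ := fun y => V y ^ ρ with hU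
  set H : Matrix (Fin d) (Fin d) ℝ := Matrix.of fun i j : Fin d => partialDeriv 2 U ![i, j] z
    with hH
  set S : ℝ := ∑ i : Fin d, partialDeriv 1 U ![i] z * a i with hS
  set s : ℝ := V z ^ δ with hs
  have hs0 : 0 < s := Real.rpow_pos_of_pos hz _
  have hG' : traceNorm G ≤ √A * s := by
    have h2 : V z ^ (2 * δ) = s ^ 2 := by
      rw [hs, ← Real.rpow_mul_natCast hz.le]; congr 1; push_cast; ring
    rw [h2] at hG
    refine (sq_le_sq₀ (Real.sqrt_nonneg _) (by positivity)).1 ?_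
    rw [mul_pow, Real.sq_sqrt hA]; exact hG
  set b : EuclideanSpace ℝ (Fin m) → EuclideanSpace ℝ (Fin d) :=
    fun ξ => WithLp.toLp 2 (G *ᵥ ξ.ofLp) with hb
  have hbcont : Continuous b := by
    have h1 : Continuous fun ξ : EuclideanSpace ℝ (Fin m) => G *ᵥ ξ.ofLp :=
      Continuous.matrix_mulVec continuous_const (PiLp.continuous_ofLp 2 _)
    exact (PiLp.continuous_toLp 2 _).comp h1
  have hbneg : ∀ ξ, b (-ξ) = -b ξ := fun ξ => by
    ext i; simp [hb, Matrix.mulVec_neg]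
  set F : EuclideanSpace ℝ (Fin m) → ℝ := fun ξ => U (z + (Δ • a + √Δ • b ξ)) with hF
  have hFcont : Continuous F := by
    have : Continuous U := hVc.contDiff.continuous.rpow_const fun _ => Or.inr hρ.le
    exact this.comp (by fun_prop)
  have hF0 : ∀ ξ, 0 ≤ F ξ := fun ξ => Real.rpow_nonneg (hV.nonneg _) _
  have hFm : Measurable fun ξ => ENNReal.ofReal (F ξ) := hFcont.measurable.ennreal_ofReal
  have hLHS : ∀ ξ : EuclideanSpace ℝ (Fin m),
      V (z + Δ • a + WithLp.toLp 2 (G *ᵥ (√Δ • ξ).ofLp)) ^ ρ = F ξ := fun ξ => by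
    simp only [hF, hU, hb]
    rw [WithLp.ofLp_smul, Matrix.mulVec_smul, WithLp.toLp_smul, add_assoc]
  simp only [hLHS]
  set q : EuclideanSpace ℝ (Fin m) → ℝ := fun ξ =>
    ∑ i, ∑ j, H i j * ((G *ᵥ ξ.ofLp) i * (G *ᵥ ξ.ofLp) j) with hq
  obtain ⟨hqint, hqval⟩ := integral_quadratic_stdGaussian G H
  set P : EuclideanSpace ℝ (Fin m) → ℝ := fun ξ =>
    V z ^ ρ * (2 + 16 * C * (A * Δ) ^ 2 * (3 + 2 * ‖ξ‖) ^ (N + 4)) + Δ * (2 * S + q ξ) with hP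
  have hVρ : 0 ≤ V z ^ ρ := Real.rpow_nonneg (hV.nonneg _) _
  have hpt : ∀ ξ, F ξ + F (-ξ) ≤ P ξ := by
    intro ξ
    -- Chosen to meet both size conditions at once: D scales like √A for the noise, and D² like A
    -- for the drift.
    set D : ℝ := 2 * √A * (1 + ‖ξ‖) with hD
    have hD0 : 0 ≤ D := by positivity
    have hbn : ‖b ξ‖ ≤ √A * s * ‖ξ‖ := (norm_toLp_mulVec_le G ξ).trans (by gcongr)
    have h1 := h z hz a (b ξ) (√Δ) D (Real.sqrt_nonneg _) hD0 ?_ ?_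
    · rw [Real.sq_sqrt hΔ, fderiv_apply_eq_sum, iteratedFDeriv_two_apply_eq_sum] at h1
      have hx : D * √Δ = 2 * √(A * Δ) * (1 + ‖ξ‖) := by rw [Real.sqrt_mul hA]; ring
      have hy1 : √(A * Δ) ≤ 1 := Real.sqrt_le_one.2 hAΔ
      have hx0 : 0 ≤ D * √Δ := by positivity
      have h2 : (D * √Δ) ^ 4 * (1 + D * √Δ) ^ N
          ≤ 16 * (A * Δ) ^ 2 * (3 + 2 * ‖ξ‖) ^ (N + 4) := by
        have h3 : (D * √Δ) ^ 4 = 16 * (A * Δ) ^ 2 * (1 + ‖ξ‖) ^ 4 := by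
          have h4 : √(A * Δ) ^ 2 = A * Δ := Real.sq_sqrt (by positivity)
          rw [hx, mul_pow, mul_pow, show √(A * Δ) ^ 4 = (√(A * Δ) ^ 2) ^ 2 by ring, h4]
          norm_num
        have h5 : 1 + D * √Δ ≤ 3 + 2 * ‖ξ‖ := by
          rw [hx]; nlinarith [norm_nonneg ξ]
        calc (D * √Δ) ^ 4 * (1 + D * √Δ) ^ N
            ≤ (16 * (A * Δ) ^ 2 * (3 + 2 * ‖ξ‖) ^ 4) * (3 + 2 * ‖ξ‖) ^ N := by
              rw [h3]
              gcongr <;> linarith [norm_nonneg ξ]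
          _ = _ := by ring
      have h6 : F (-ξ) = V (z + (Δ • a - √Δ • b ξ)) ^ ρ := by
        simp only [hF, hbneg, smul_neg, sub_eq_add_neg, hU]
      have h7 : V z ^ ρ * (2 + C * ((D * √Δ) ^ 4 * (1 + D * √Δ) ^ N))
          ≤ V z ^ ρ * (2 + 16 * C * (A * Δ) ^ 2 * (3 + 2 * ‖ξ‖) ^ (N + 4)) := by
        refine mul_le_mul_of_nonneg_left ?_ hVρ
        have := mul_le_mul_of_nonneg_left h2 hC
        linarith
      rw [h6]
      refine h1.trans ?_
      simp only [hP]
      have h8 : ∑ i : Fin d, ∑ j : Fin d, partialDeriv 2 (fun y => V y ^ ρ) ![i, j] z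
          * ((b ξ) i * (b ξ) j) = q ξ := by simp [hq, hH, hb, hU]
      rw [h8]
      linarith
    · have h4 : √A ^ 2 = A := Real.sq_sqrt hA
      calc 2 * ‖a‖ ≤ 2 * (A * s) := by gcongr
        _ ≤ 4 * A * s * (1 + ‖ξ‖) ^ 2 := by
          have h5 : 1 ≤ (1 + ‖ξ‖) ^ 2 := one_le_pow₀ (by linarith [norm_nonneg ξ])
          have h6 : 0 ≤ A * s := by positivity
          nlinarith
        _ = D ^ 2 * s := by rw [hD, mul_pow, mul_pow, h4]; ring
    · calc 2 * ‖b ξ‖ ≤ 2 * (√A * s * ‖ξ‖) := by gcongr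
        _ ≤ 2 * (√A * s * (1 + ‖ξ‖)) := by gcongr; linarith
        _ = D * s := by rw [hD]; ring
  have hPint : Integrable P ν := by
    refine Integrable.add ?_ ?_
    · exact (((integrable_const (2 : ℝ)).add
        ((integrable_polynomial_norm_stdGaussian (N + 4)).const_mul _)).const_mul _)
    · exact ((integrable_const (2 * S)).add hqint).const_mul _
  have hPval : ∫ ξ, P ξ ∂ν = 2 * (V z ^ ρ * (1 + 8 * C * I * (A * Δ) ^ 2) + Δ *
      (S + (1 / 2) * (Gᵀ * H * G).trace)) := by
    have e1 : ∫ ξ, P ξ ∂ν = ∫ ξ : EuclideanSpace ℝ (Fin m),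
        V z ^ ρ * (2 + 16 * C * (A * Δ) ^ 2 * (3 + 2 * ‖ξ‖) ^ (N + 4)) ∂ν
        + ∫ ξ, Δ * (2 * S + q ξ) ∂ν :=
      integral_add (((integrable_const (2 : ℝ)).add
        ((integrable_polynomial_norm_stdGaussian (N + 4)).const_mul _)).const_mul _)
        (((integrable_const (2 * S)).add hqint).const_mul _)
    have e2 : ∫ ξ : EuclideanSpace ℝ (Fin m),
        (2 + 16 * C * (A * Δ) ^ 2 * (3 + 2 * ‖ξ‖) ^ (N + 4)) ∂ν
        = 2 + 16 * C * (A * Δ) ^ 2 * I := by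
      rw [integral_add (integrable_const _)
        ((integrable_polynomial_norm_stdGaussian (N + 4)).const_mul _), integral_const_mul, ← hI]
      simp
    have e3 : ∫ ξ, (2 * S + q ξ) ∂ν = 2 * S + (Gᵀ * H * G).trace := by
      rw [integral_add (integrable_const _) hqint, ← hqval]
      simp
    rw [e1, integral_const_mul, integral_const_mul, e2, e3]
    ring
  -- With the lower integral, F need not be known to be integrable; only the majorant P, which is
  -- nonnegative because it dominates F(ξ) + F(-ξ), must be.
  have hsum : 2 * ∫⁻ ξ, ENNReal.ofReal (F ξ) ∂ν ≤ ENNReal.ofReal (∫ ξ, P ξ ∂ν) := by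
    calc 2 * ∫⁻ ξ, ENNReal.ofReal (F ξ) ∂ν
        = ∫⁻ ξ, ENNReal.ofReal (F ξ) ∂ν + ∫⁻ ξ, ENNReal.ofReal (F (-ξ)) ∂ν := by
          rw [lintegral_comp_neg_stdGaussian _ hFm, two_mul]
      _ = ∫⁻ ξ, ENNReal.ofReal (F ξ + F (-ξ)) ∂ν := by
          rw [← lintegral_add_left hFm]
          refine lintegral_congr fun ξ => ?_
          rw [ENNReal.ofReal_add (hF0 _) (hF0 _)]
      _ ≤ ∫⁻ ξ, ENNReal.ofReal (P ξ) ∂ν :=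
          lintegral_mono fun ξ => ENNReal.ofReal_le_ofReal (hpt ξ)
      _ = ENNReal.ofReal (∫ ξ, P ξ ∂ν) :=
          (ofReal_integral_eq_lintegral_ofReal hPint (ae_of_all _ fun ξ =>
            (add_nonneg (hF0 _) (hF0 _)).trans (hpt ξ))).symm
  rw [hPval, ENNReal.ofReal_mul (by norm_num), ENNReal.ofReal_ofNat] at hsum
  exact (ENNReal.mul_le_mul_iff_right (by norm_num) (by norm_num)).1 hsum

end Gaussian

/-! ### Independence and law of the Brownian increments on the grid. -/

section Increments

variable {m : ℕ} {Ω : Type*} [MeasurableSpace Ω] {P : Measure Ω}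
  {B : ℝ≥0 → Ω → EuclideanSpace ℝ (Fin m)}

/-- The increments of the Brownian motion over the grid with mesh `Δ`. -/
def increment (B : ℝ≥0 → Ω → EuclideanSpace ℝ (Fin m)) (Δ : ℝ) (k : ℕ) (ω : Ω) :
    EuclideanSpace ℝ (Fin m) :=
  B (((k : ℝ) + 1) * Δ).toNNReal ω - B ((k : ℝ) * Δ).toNNReal ω

lemma IsBrownianMotion.measurable_increment (hB : IsBrownianMotion B P) (Δ : ℝ) (k : ℕ) :
    Measurable (increment B Δ k) :=
  (hB.measurable _).sub (hB.measurable _)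

/-- Independence holds at two levels: between coordinate processes, and between time increments
within each coordinate. Together they give joint independence over all pairs (coordinate, time). -/
lemma IsBrownianMotion.iIndepFun_increment_coord (hB : IsBrownianMotion B P) {Δ : ℝ}
    (hΔ : 0 ≤ Δ) :
    iIndepFun (fun (p : Fin m × ℕ) ω => increment B Δ p.2 ω p.1) P := by
  have hmeas : ∀ (j : Fin m) (k : ℕ), Measurable fun ω => increment B Δ k ω j := fun j k =>
    (EuclideanSpace.proj (𝕜 := ℝ) j).continuous.measurable.comp (hB.measurable_increment Δ k)
  refine iIndepFun_uncurry' (X := fun (j : Fin m) (k : ℕ) ω => increment B Δ k ω j) hmeas ?_ ?_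
  · exact hB.indep_coord.comp
      (fun _ (x : ℝ≥0 → ℝ) (k : ℕ) =>
        x (((k : ℝ) + 1) * Δ).toNNReal - x ((k : ℝ) * Δ).toNNReal)
      (fun _ => measurable_pi_lambda _ fun k =>
        (measurable_pi_apply _).sub (measurable_pi_apply _))
  · intro j
    have hmono : Monotone fun k : ℕ => ((k : ℝ) * Δ).toNNReal := fun k l hkl =>
      Real.toNNReal_le_toNNReal (by gcongr)
    have := (hB.isBrownianReal_coord j).hasIndepIncrements.nat hmono
    simpa [increment] using this

lemma IsBrownianMotion.hasLaw_increment_coord (hB : IsBrownianMotion B P) {Δ : ℝ}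
    (hΔ : 0 ≤ Δ) (k : ℕ) (j : Fin m) :
    P.map (fun ω => increment B Δ k ω j) = gaussianReal 0 Δ.toNNReal := by
  have h := ((hB.isBrownianReal_coord j).hasLaw_sub (((k : ℝ) + 1) * Δ).toNNReal
    ((k : ℝ) * Δ).toNNReal).map_eq
  have hd : nndist ((((k : ℝ) + 1) * Δ).toNNReal : ℝ) (((k : ℝ) * Δ).toNNReal : ℝ)
      = Δ.toNNReal := by
    ext
    rw [coe_nndist, Real.dist_eq, Real.coe_toNNReal _ (by positivity),
      Real.coe_toNNReal _ (by positivity), Real.coe_toNNReal _ hΔ,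
      show ((k : ℝ) + 1) * Δ - k * Δ = Δ by ring, abs_of_nonneg hΔ]
  erw [hd] at h
  rw [← h]
  rfl

/-- The increments have the law of `√Δ ξ` with `ξ` standard Gaussian. -/
lemma IsBrownianMotion.map_increment (hB : IsBrownianMotion B P) {Δ : ℝ} (hΔ : 0 ≤ Δ) (k : ℕ) :
    P.map (increment B Δ k)
      = (stdGaussian (EuclideanSpace ℝ (Fin m))).map (fun ξ => √Δ • ξ) := by
  have hmeas : ∀ j : Fin m, Measurable fun ω => increment B Δ k ω j := fun j =>
    (EuclideanSpace.proj (𝕜 := ℝ) j).continuous.measurable.comp (hB.measurable_increment Δ k)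
  have hind : iIndepFun (fun (j : Fin m) ω => increment B Δ k ω j) P :=
    (hB.iIndepFun_increment_coord hΔ).precomp (g := fun j : Fin m => (j, k))
      (fun i j h => (Prod.ext_iff.1 h).1)
  have h1 := hind.map_fun_eq_pi_map fun j => (hmeas j).aemeasurable
  simp only [hB.hasLaw_increment_coord hΔ k] at h1
  have h2 : gaussianReal 0 Δ.toNNReal = (gaussianReal 0 1).map (fun x => √Δ * x) := by
    rw [gaussianReal_map_const_mul]
    congr 1
    · simp
    · ext; simp [Real.sq_sqrt hΔ, Real.coe_toNNReal _ hΔ]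
  have h3 : (increment B Δ k) = (WithLp.toLp 2) ∘ fun ω (j : Fin m) => increment B Δ k ω j := by
    funext ω; rfl
  rw [h3, ← Measure.map_map (by fun_prop) (measurable_pi_lambda _ hmeas), h1,
    ← map_pi_eq_stdGaussian, Measure.map_map (by fun_prop) (by fun_prop)]
  have h4 : Measure.pi (fun _ : Fin m => gaussianReal 0 Δ.toNNReal)
      = (Measure.pi fun _ : Fin m => gaussianReal 0 1).map (fun x i => √Δ * x i) := by
    rw [Measure.pi_map_pi (fun i => by fun_prop), ← h2]
  rw [h4, Measure.map_map (by fun_prop) (by fun_prop)]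
  congr 1

end Increments

/-! ### The radial truncation. -/

section Truncation

variable {d : ℕ}

lemma norm_radialTruncation_le {R : ℝ} (hR : 0 ≤ R) (x : EuclideanSpace ℝ (Fin d)) :
    ‖radialTruncation R x‖ ≤ R := by
  rw [radialTruncation, norm_smul, norm_smul, norm_inv, norm_norm,
    Real.norm_of_nonneg (le_min (norm_nonneg _) hR)]
  calc min ‖x‖ R * (‖x‖⁻¹ * ‖x‖) ≤ min ‖x‖ R * 1 :=
        mul_le_mul_of_nonneg_left inv_mul_le_one (le_min (norm_nonneg _) hR)
    _ ≤ R := by rw [mul_one]; exact min_le_right _ _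

/-- For x ≠ 0 the truncation multiplies x by min(‖x‖, R)/‖x‖ ∈ (0, 1], so the scaling hypothesis on
V applies. -/
lemma radialTruncation_le {R : ℝ} (hR : 0 < R) {V : EuclideanSpace ℝ (Fin d) → ℝ}
    (hVscale : ∀ (x : EuclideanSpace ℝ (Fin d)) (ε : ℝ), 0 < ε → ε ≤ 1 → V (ε • x) ≤ V x)
    (x : EuclideanSpace ℝ (Fin d)) : V (radialTruncation R x) ≤ V x := by
  by_cases hx : x = 0
  · simp [hx, radialTruncation]
  · have hx' : 0 < ‖x‖ := norm_pos_iff.2 hx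
    rw [radialTruncation, smul_smul]
    refine hVscale x _ (mul_pos (lt_min hx' hR) (inv_pos.2 hx')) ?_
    rw [← div_eq_mul_inv, div_le_one hx']
    exact min_le_left _ _

lemma measurable_radialTruncation (R : ℝ) :
    Measurable (radialTruncation R : EuclideanSpace ℝ (Fin d) → _) := by
  unfold radialTruncation
  fun_prop

end Truncation

/-! ### Continuity of the coefficients. -/

section Coefficients

variable {d m : ℕ}

lemma LocallyLipschitzCoeff.continuous {f : EuclideanSpace ℝ (Fin d) → EuclideanSpace ℝ (Fin d)}
    {g : EuclideanSpace ℝ (Fin d) → Matrix (Fin d) (Fin m) ℝ} (h : LocallyLipschitzCoeff f g) :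
    Continuous f ∧ Continuous g := by
  have hball : ∀ x : EuclideanSpace ℝ (Fin d), ∃ C : ℝ, ∀ᶠ y in 𝓝 x,
      ‖f y - f x‖ ≤ C * ‖y - x‖ ∧ ∀ i j, |g y i j - g x i j| ≤ C * ‖y - x‖ := by
    intro x
    obtain ⟨C, hC, hlip⟩ := h (‖x‖ + 1) (by positivity)
    refine ⟨C, ?_⟩
    filter_upwards [Metric.ball_mem_nhds x one_pos] with y hy
    have hy' : ‖y‖ ≤ ‖x‖ + 1 := by
      have h1 : ‖y‖ ≤ ‖x‖ + ‖y - x‖ := by simpa using norm_add_le x (y - x)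
      rw [Metric.mem_ball, dist_eq_norm] at hy
      linarith
    have h1 := hlip y x (max_le hy' (by linarith))
    refine ⟨(le_max_left _ _).trans h1, fun i j => ?_⟩
    refine le_trans ?_ ((le_max_right _ _).trans h1)
    refine abs_le_of_sq_le_sq ?_ (Real.sqrt_nonneg _)
    rw [traceNorm_sq]
    calc (g y i j - g x i j) ^ 2 ≤ ∑ j, (g y - g x) i j ^ 2 :=
          Finset.single_le_sum (f := fun j => (g y - g x) i j ^ 2) (fun _ _ => sq_nonneg _)
            (Finset.mem_univ j)
      _ ≤ _ := Finset.single_le_sum (f := fun i => ∑ j, (g y - g x) i j ^ 2)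
            (fun _ _ => by positivity) (Finset.mem_univ i)
  have hlim : ∀ (x : EuclideanSpace ℝ (Fin d)) (C : ℝ),
      Tendsto (fun y => C * ‖y - x‖) (𝓝 x) (𝓝 0) := by
    intro x C
    have : Continuous fun y : EuclideanSpace ℝ (Fin d) => C * ‖y - x‖ := by fun_prop
    simpa using this.tendsto x
  constructor
  · refine continuous_iff_continuousAt.2 fun x => ?_
    obtain ⟨C, hC⟩ := hball x
    refine tendsto_iff_norm_sub_tendsto_zero.2 ?_
    exact squeeze_zero' (Eventually.of_forall fun _ => norm_nonneg _) (hC.mono fun y hy => hy.1)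
      (hlim x C)
  · refine continuous_matrix fun i j => continuous_iff_continuousAt.2 fun x => ?_
    obtain ⟨C, hC⟩ := hball x
    refine tendsto_iff_norm_sub_tendsto_zero.2 ?_
    exact squeeze_zero' (Eventually.of_forall fun _ => norm_nonneg _)
      (hC.mono fun y hy => hy.2 i j) (hlim x C)

end Coefficients

/-! ### The scheme as a measurable function of past increments. -/

section EulerStep

variable {d m : ℕ} {Ω : Type*} {B : ℝ≥0 → Ω → EuclideanSpace ℝ (Fin m)}
  {f : EuclideanSpace ℝ (Fin d) → EuclideanSpace ℝ (Fin d)}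
  {g : EuclideanSpace ℝ (Fin d) → Matrix (Fin d) (Fin m) ℝ}

/-- One step of the Euler–Maruyama scheme, before truncation. -/
def eulerStep (f : EuclideanSpace ℝ (Fin d) → EuclideanSpace ℝ (Fin d))
    (g : EuclideanSpace ℝ (Fin d) → Matrix (Fin d) (Fin m) ℝ) (Δ : ℝ)
    (z : EuclideanSpace ℝ (Fin d)) (b : EuclideanSpace ℝ (Fin m)) : EuclideanSpace ℝ (Fin d) :=
  z + Δ • f z + WithLp.toLp 2 (g z *ᵥ b.ofLp)

lemma scheme_succ (φ : ℝ → ℝ) (K θ : ℝ) (x₀ : EuclideanSpace ℝ (Fin d)) (Δ : ℝ)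
    (k : ℕ) (ω : Ω) :
    scheme f g φ K θ x₀ B Δ (k + 1) ω = radialTruncation (inversePos φ (K * Δ ^ (-θ)))
      (eulerStep f g Δ (scheme f g φ K θ x₀ B Δ k ω) (increment B Δ k ω)) := rfl

lemma continuous_eulerStep (hfg : LocallyLipschitzCoeff f g) (Δ : ℝ) :
    Continuous fun p : EuclideanSpace ℝ (Fin d) × EuclideanSpace ℝ (Fin m) =>
      eulerStep f g Δ p.1 p.2 := by
  obtain ⟨hf, hg⟩ := hfg.continuous
  unfold eulerStep
  have h1 : Continuous fun p : EuclideanSpace ℝ (Fin d) × EuclideanSpace ℝ (Fin m) =>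
      g p.1 *ᵥ p.2.ofLp :=
    Continuous.matrix_mulVec (hg.comp continuous_fst)
      ((PiLp.continuous_ofLp 2 _).comp continuous_snd)
  exact (continuous_fst.add ((hf.comp continuous_fst).const_smul Δ)).add
    ((PiLp.continuous_toLp 2 _).comp h1)

/-- The scheme at time `k` is a measurable function of the first `k` increments. -/
lemma exists_scheme_eq (hfg : LocallyLipschitzCoeff f g) (φ : ℝ → ℝ) (K θ : ℝ)
    (x₀ : EuclideanSpace ℝ (Fin d)) (Δ : ℝ) (k : ℕ) :
    ∃ Ψ : ((Fin m × Finset.range k) → ℝ) → EuclideanSpace ℝ (Fin d), Measurable Ψ ∧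
      ∀ ω, scheme f g φ K θ x₀ B Δ k ω = Ψ fun p => increment B Δ p.2 ω p.1 := by
  induction k with
  | zero => exact ⟨fun _ => x₀, measurable_const, fun ω => rfl⟩
  | succ k ih =>
    obtain ⟨Ψ, hΨ, h⟩ := ih
    refine ⟨fun x => radialTruncation (inversePos φ (K * Δ ^ (-θ)))
      (eulerStep f g Δ (Ψ fun p => x (p.1, ⟨p.2, Finset.mem_range.2
        ((Finset.mem_range.1 p.2.2).trans (Nat.lt_succ_self k))⟩))
        (WithLp.toLp 2 fun j => x (j, ⟨k, Finset.self_mem_range_succ k⟩))), ?_, fun ω => ?_⟩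
    · refine (measurable_radialTruncation _).comp
        ((continuous_eulerStep hfg Δ).measurable.comp (Measurable.prodMk ?_ ?_))
      · exact hΨ.comp (by fun_prop)
      · have : Measurable fun (x : (Fin m × Finset.range (k + 1)) → ℝ) (j : Fin m) =>
          x (j, ⟨k, Finset.self_mem_range_succ k⟩) := by fun_prop
        exact (PiLp.continuous_toLp 2 _).measurable.comp this
    · rw [scheme_succ, h ω]

end EulerStep

/-! ### Markov structure of the scheme. -/

section Scheme

variable {d m : ℕ} {Ω : Type*} [MeasurableSpace Ω] {P : Measure Ω}
  {B : ℝ≥0 → Ω → EuclideanSpace ℝ (Fin m)}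
  {f : EuclideanSpace ℝ (Fin d) → EuclideanSpace ℝ (Fin d)}
  {g : EuclideanSpace ℝ (Fin d) → Matrix (Fin d) (Fin m) ℝ}

lemma IsBrownianMotion.measurable_scheme (hB : IsBrownianMotion B P)
    (hfg : LocallyLipschitzCoeff f g) (φ : ℝ → ℝ) (K θ : ℝ)
    (x₀ : EuclideanSpace ℝ (Fin d)) (Δ : ℝ) (k : ℕ) :
    Measurable (scheme f g φ K θ x₀ B Δ k) := by
  obtain ⟨Ψ, hΨ, h⟩ := exists_scheme_eq (B := B) hfg φ K θ x₀ Δ k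
  rw [funext h]
  exact hΨ.comp (measurable_pi_lambda _ fun p =>
    (EuclideanSpace.proj (𝕜 := ℝ) p.1).continuous.measurable.comp (hB.measurable_increment Δ p.2))

/-- The state uses only increments with time index below k, so the two variables are functions of
disjoint blocks of one independent family. -/
lemma IsBrownianMotion.indepFun_scheme_increment (hB : IsBrownianMotion B P)
    (hfg : LocallyLipschitzCoeff f g) (φ : ℝ → ℝ) (K θ : ℝ)
    (x₀ : EuclideanSpace ℝ (Fin d)) {Δ : ℝ} (hΔ : 0 ≤ Δ) (k : ℕ) :
    IndepFun (scheme f g φ K θ x₀ B Δ k) (increment B Δ k) P := by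
  classical
  obtain ⟨Ψ, hΨ, h⟩ := exists_scheme_eq (B := B) hfg φ K θ x₀ Δ k
  have hind := (hB.iIndepFun_increment_coord hΔ).indepFun_finset
    (Finset.univ ×ˢ Finset.range k) (Finset.univ ×ˢ {k})
    (Finset.disjoint_left.2 fun p hp hp' => by
      simp only [Finset.mem_product, Finset.mem_univ, true_and, Finset.mem_range,
        Finset.mem_singleton] at hp hp'
      omega)
    (fun p => (EuclideanSpace.proj (𝕜 := ℝ) p.1).continuous.measurable.comp
      (hB.measurable_increment Δ p.2))
  have h1 := hind.comp
    (φ := fun x => Ψ fun p => x ⟨(p.1, p.2), by simp⟩)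
    (ψ := fun x => WithLp.toLp 2 fun j : Fin m => x ⟨(j, k), by simp⟩)
    (hΨ.comp (measurable_pi_lambda _ fun _ => measurable_pi_apply _))
    ((PiLp.continuous_toLp 2 _).measurable.comp
      (measurable_pi_lambda _ fun _ => measurable_pi_apply _))
  rw [funext h]
  exact h1

/-- Conditioning on the state at time `k`: the expectation of a function of one further step. -/
lemma IsBrownianMotion.lintegral_step [IsProbabilityMeasure P] (hB : IsBrownianMotion B P)
    (hfg : LocallyLipschitzCoeff f g) (φ : ℝ → ℝ) (K θ : ℝ)
    (x₀ : EuclideanSpace ℝ (Fin d)) {Δ : ℝ} (hΔ : 0 ≤ Δ) (k : ℕ)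
    {U : EuclideanSpace ℝ (Fin d) → ℝ≥0∞} (hU : Measurable U) :
    ∫⁻ ω, U (eulerStep f g Δ (scheme f g φ K θ x₀ B Δ k ω) (increment B Δ k ω)) ∂P
      = ∫⁻ ω, ∫⁻ ξ, U (eulerStep f g Δ (scheme f g φ K θ x₀ B Δ k ω) (√Δ • ξ))
          ∂(stdGaussian (EuclideanSpace ℝ (Fin m))) ∂P := by
  have hZ := hB.measurable_scheme hfg φ K θ x₀ Δ k
  have hI := hB.measurable_increment Δ k
  have hmeas : Measurable fun p : EuclideanSpace ℝ (Fin d) × EuclideanSpace ℝ (Fin m) =>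
      U (eulerStep f g Δ p.1 p.2) := hU.comp (continuous_eulerStep hfg Δ).measurable
  have hprod := (indepFun_iff_map_prod_eq_prod_map_map hZ.aemeasurable hI.aemeasurable).1
    (hB.indepFun_scheme_increment hfg φ K θ x₀ hΔ k)
  have hprob : IsProbabilityMeasure (P.map (increment B Δ k)) :=
    Measure.isProbabilityMeasure_map hI.aemeasurable
  calc _ = ∫⁻ p, U (eulerStep f g Δ p.1 p.2)
        ∂(P.map fun ω => (scheme f g φ K θ x₀ B Δ k ω, increment B Δ k ω)) :=
        (lintegral_map hmeas (hZ.prodMk hI)).symm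
    _ = ∫⁻ z, ∫⁻ b, U (eulerStep f g Δ z b) ∂(P.map (increment B Δ k))
          ∂(P.map (scheme f g φ K θ x₀ B Δ k)) := by
        rw [hprod, lintegral_prod _ hmeas.aemeasurable]
    _ = ∫⁻ ω, ∫⁻ b, U (eulerStep f g Δ (scheme f g φ K θ x₀ B Δ k ω) b)
          ∂(P.map (increment B Δ k)) ∂P := lintegral_map hmeas.lintegral_prod_right' hZ
    _ = _ := by
        refine lintegral_congr fun ω => ?_
        rw [hB.map_increment hΔ k]
        exact lintegral_map (hmeas.comp measurable_prodMk_left) (by fun_prop)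

end Scheme

/-! ### Contraction, moment decay and logarithmic rates. -/

section Decay

variable {d m : ℕ}

/-- The chosen inverse is meaningful only at values φ attains; the intermediate value theorem,
started at u, shows that y is one of them. -/
lemma inversePos_spec {φ : ℝ → ℝ} (hφ_mono : StrictMonoOn φ (Ioi 0))
    (hφ_cont : ContinuousOn φ (Ioi 0)) (hφ_lim : Tendsto φ atTop atTop) {u y : ℝ} (hu : 0 < u)
    (hy : φ u ≤ y) : φ (inversePos φ y) = y ∧ u ≤ inversePos φ y := by
  have hex : ∃ x ∈ Ioi (0 : ℝ), φ x = y := by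
    obtain ⟨v, hv⟩ := ((hφ_lim.eventually_ge_atTop y).and (eventually_ge_atTop u)).exists
    obtain ⟨x, hx, hxy⟩ := intermediate_value_Icc hv.2
      (hφ_cont.mono fun x hx => lt_of_lt_of_le hu hx.1) ⟨hy, hv.1⟩
    exact ⟨x, lt_of_lt_of_le hu hx.1, hxy⟩
  have h1 : inversePos φ y ∈ Ioi (0 : ℝ) := Function.invFunOn_mem hex
  have h2 : φ (inversePos φ y) = y := Function.invFunOn_eq hex
  exact ⟨h2, (hφ_mono.le_iff_le hu h1).1 (by rw [h2]; exact hy)⟩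

/-- The one-step contraction, given bounds on the coefficients at the current state. -/
lemma lintegral_eulerStep_le {δ ρ C A Δ μ ϱ : ℝ}
    {V w : EuclideanSpace ℝ (Fin d) → ℝ}
    {f : EuclideanSpace ℝ (Fin d) → EuclideanSpace ℝ (Fin d)}
    {g : EuclideanSpace ℝ (Fin d) → Matrix (Fin d) (Fin m) ℝ} (hρ : 0 < ρ)
    (hV : IsLyapunovClass 4 δ V) (hf0 : f 0 = 0) (hg0 : g 0 = 0)
    (hC : ∀ z, 0 < V z → ∀ (a : EuclideanSpace ℝ (Fin d))
      (G : Matrix (Fin d) (Fin m) ℝ) (A Δ : ℝ), 0 ≤ A → 0 ≤ Δ → A * Δ ≤ 1 → ‖a‖ ≤ A * V z ^ δ →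
      traceNorm G ^ 2 ≤ A * V z ^ (2 * δ) →
      ∫⁻ ξ : EuclideanSpace ℝ (Fin m),
          ENNReal.ofReal (V (z + Δ • a + WithLp.toLp 2 (G *ᵥ (√Δ • ξ).ofLp)) ^ ρ)
          ∂(stdGaussian (EuclideanSpace ℝ (Fin m)))
        ≤ ENNReal.ofReal (V z ^ ρ * (1 + C * (A * Δ) ^ 2) + Δ *
          ((∑ i : Fin d, partialDeriv 1 (fun y => V y ^ ρ) ![i] z * a i) + (1 / 2) *
            (Gᵀ * (Matrix.of fun i j : Fin d => partialDeriv 2 (fun y => V y ^ ρ) ![i, j] z)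
              * G).trace)))
    (hLV : ∀ x, generator f g (fun y => V y ^ ρ) x ≤ -w x) (hwV : ∀ x, μ * V x ^ ρ ≤ w x)
    (hA : 0 ≤ A) (hΔ : 0 ≤ Δ) (hAΔ : A * Δ ≤ 1) (hCA : C * (A * Δ) ^ 2 ≤ ϱ * Δ)
    {z : EuclideanSpace ℝ (Fin d)}
    (hz : z ≠ 0 → ‖f z‖ ≤ A * V z ^ δ ∧ traceNorm (g z) ^ 2 ≤ A * V z ^ (2 * δ)) :
    ∫⁻ ξ : EuclideanSpace ℝ (Fin m), ENNReal.ofReal (V (eulerStep f g Δ z (√Δ • ξ)) ^ ρ)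
        ∂(stdGaussian (EuclideanSpace ℝ (Fin m)))
      ≤ ENNReal.ofReal (Real.exp (-((μ - ϱ) * Δ))) * ENNReal.ofReal (V z ^ ρ) := by
  have hker : ∀ x, V x = 0 ↔ x = 0 := fun x => by
    have := hV.ker_eq
    rw [Set.ext_iff] at this
    simpa using this x
  -- At the origin V^ρ need not be differentiable, but the step stays there because both
  -- coefficients vanish, and both sides are 0.
  by_cases h0 : z = 0
  · have hV0 : V 0 = 0 := (hker 0).2 rfl
    simp [h0, eulerStep, hf0, hg0, hV0, Real.zero_rpow hρ.ne']
  · have hVz : 0 < V z := lt_of_le_of_ne (hV.nonneg z) fun h => h0 ((hker z).1 h.symm)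
    have hVρ : 0 ≤ V z ^ ρ := Real.rpow_nonneg hVz.le _
    refine (hC z hVz (f z) (g z) A Δ hA hΔ hAΔ (hz h0).1 (hz h0).2).trans ?_
    rw [← ENNReal.ofReal_mul (Real.exp_pos _).le]
    refine ENNReal.ofReal_le_ofReal ?_
    have h1 : (∑ i : Fin d, partialDeriv 1 (fun y => V y ^ ρ) ![i] z * f z i) + (1 / 2) *
        ((g z)ᵀ * (Matrix.of fun i j : Fin d => partialDeriv 2 (fun y => V y ^ ρ) ![i, j] z)
          * g z).trace ≤ -(μ * V z ^ ρ) := (hLV z).trans (neg_le_neg (hwV z))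
    have h2 := Real.add_one_le_exp (-((μ - ϱ) * Δ))
    calc _ ≤ V z ^ ρ * (1 + ϱ * Δ) + Δ * (-(μ * V z ^ ρ)) := by gcongr
      _ = (-((μ - ϱ) * Δ) + 1) * V z ^ ρ := by ring
      _ ≤ _ := by gcongr

/-- Geometric decay of the moments of the truncated scheme. -/
lemma IsBrownianMotion.lintegral_scheme_le {Ω : Type*} [MeasurableSpace Ω] {P : Measure Ω}
    [IsProbabilityMeasure P] {B : ℝ≥0 → Ω → EuclideanSpace ℝ (Fin m)} (hB : IsBrownianMotion B P)
    {f : EuclideanSpace ℝ (Fin d) → EuclideanSpace ℝ (Fin d)}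
    {g : EuclideanSpace ℝ (Fin d) → Matrix (Fin d) (Fin m) ℝ}
    (hfg : LocallyLipschitzCoeff f g) {φ : ℝ → ℝ} {K θ : ℝ} {x₀ : EuclideanSpace ℝ (Fin d)}
    {Δ ρ q : ℝ} (hΔ : 0 ≤ Δ) (hρ : 0 < ρ) {V : EuclideanSpace ℝ (Fin d) → ℝ} (hVc : Continuous V)
    (hV0 : ∀ x, 0 ≤ V x)
    (hVscale : ∀ (x : EuclideanSpace ℝ (Fin d)) (ε : ℝ), 0 < ε → ε ≤ 1 → V (ε • x) ≤ V x)
    (hR : 0 < inversePos φ (K * Δ ^ (-θ))) (hx₀ : ‖x₀‖ ≤ inversePos φ (K * Δ ^ (-θ)))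
    (hstep : ∀ z : EuclideanSpace ℝ (Fin d), ‖z‖ ≤ inversePos φ (K * Δ ^ (-θ)) →
      ∫⁻ ξ : EuclideanSpace ℝ (Fin m), ENNReal.ofReal (V (eulerStep f g Δ z (√Δ • ξ)) ^ ρ)
        ∂(stdGaussian (EuclideanSpace ℝ (Fin m)))
      ≤ ENNReal.ofReal (Real.exp (-q)) * ENNReal.ofReal (V z ^ ρ)) (k : ℕ) :
    ∫⁻ ω, ENNReal.ofReal (V (scheme f g φ K θ x₀ B Δ k ω) ^ ρ) ∂P
      ≤ ENNReal.ofReal (V x₀ ^ ρ * Real.exp (-(k * q))) := by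
  have hU : Continuous fun x => V x ^ ρ := hVc.rpow_const fun _ => Or.inr hρ.le
  have hUm : Measurable fun x => ENNReal.ofReal (V x ^ ρ) := hU.measurable.ennreal_ofReal
  have hbdd : ∀ k ω, ‖scheme f g φ K θ x₀ B Δ k ω‖ ≤ inversePos φ (K * Δ ^ (-θ)) := by
    intro k ω
    cases k with
    | zero => exact hx₀
    | succ k => rw [scheme_succ]; exact norm_radialTruncation_le hR.le _
  induction k with
  | zero => simp [scheme]
  | succ k ih =>
    calc ∫⁻ ω, ENNReal.ofReal (V (scheme f g φ K θ x₀ B Δ (k + 1) ω) ^ ρ) ∂P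
        ≤ ∫⁻ ω, ENNReal.ofReal (V (eulerStep f g Δ (scheme f g φ K θ x₀ B Δ k ω)
            (increment B Δ k ω)) ^ ρ) ∂P := by
          refine lintegral_mono fun ω => ENNReal.ofReal_le_ofReal ?_
          rw [scheme_succ]
          exact Real.rpow_le_rpow (hV0 _) (radialTruncation_le hR hVscale _) hρ.le
      _ = _ := hB.lintegral_step hfg φ K θ x₀ hΔ k hUm
      _ ≤ ∫⁻ ω, ENNReal.ofReal (Real.exp (-q))
            * ENNReal.ofReal (V (scheme f g φ K θ x₀ B Δ k ω) ^ ρ) ∂P :=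
          lintegral_mono fun ω => hstep _ (hbdd k ω)
      _ = ENNReal.ofReal (Real.exp (-q))
            * ∫⁻ ω, ENNReal.ofReal (V (scheme f g φ K θ x₀ B Δ k ω) ^ ρ) ∂P :=
          lintegral_const_mul _ (hUm.comp (hB.measurable_scheme hfg φ K θ x₀ Δ k))
      _ ≤ ENNReal.ofReal (Real.exp (-q)) * ENNReal.ofReal (V x₀ ^ ρ * Real.exp (-(k * q))) := by
          gcongr
      _ = _ := by
          rw [← ENNReal.ofReal_mul (Real.exp_pos _).le, mul_left_comm, ← Real.exp_add]
          congr 3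
          push_cast; ring

/-- Constant and polynomial prefactors do not affect an exponential rate, since log(k+1)/k → 0. The
moment bound takes κ = 0 and the pathwise bound κ = 2/ρ. -/
lemma limsup_log_div_le {x : ℕ → ℝ≥0∞} {c lam Δ : ℝ} {κ : ℝ} (hΔ : 0 < Δ)
    (hx : ∀ k : ℕ, x k ≤ ENNReal.ofReal (Real.exp (c + κ * Real.log (k + 1) - lam * (k * Δ)))) :
    limsup (fun k : ℕ => ENNReal.log (x k) / (((k : ℝ) * Δ : ℝ) : EReal)) atTop
      ≤ ((-lam : ℝ) : EReal) := by
  have hlog : Tendsto (fun k : ℕ => Real.log ((k : ℝ) + 1) / k) atTop (𝓝 0) := by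
    have h1 : Tendsto (fun k : ℕ => Real.log ((k + 1 : ℕ) : ℝ) / ((k + 1 : ℕ) : ℝ)) atTop (𝓝 0) :=
      (Real.isLittleO_log_id_atTop.tendsto_div_nhds_zero.comp
        (tendsto_natCast_atTop_atTop.comp (tendsto_add_atTop_nat 1)))
    have h2 : Tendsto (fun k : ℕ => 1 + 1 / (k : ℝ)) atTop (𝓝 (1 + 0)) :=
      tendsto_const_nhds.add (tendsto_const_div_atTop_nhds_zero_nat 1)
    have h3 := h1.mul h2
    rw [zero_mul] at h3
    refine h3.congr' ?_
    filter_upwards [eventually_gt_atTop 0] with k hk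
    have : (k : ℝ) ≠ 0 := by positivity
    have : (k : ℝ) + 1 ≠ 0 := by positivity
    push_cast
    field_simp
  have hlim : Tendsto (fun k : ℕ =>
      (c + κ * Real.log (k + 1) - lam * (k * Δ)) / ((k : ℝ) * Δ)) atTop (𝓝 (-lam)) := by
    have h1 : Tendsto (fun k : ℕ => c / Δ / (k : ℝ) + κ / Δ * (Real.log ((k : ℝ) + 1) / k) - lam)
        atTop (𝓝 (0 + κ / Δ * 0 - lam)) :=
      ((tendsto_const_div_atTop_nhds_zero_nat _).add (hlog.const_mul _)).sub_const _
    rw [mul_zero, zero_add, zero_sub] at h1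
    refine h1.congr' ?_
    filter_upwards [eventually_gt_atTop 0] with k hk
    have : (k : ℝ) ≠ 0 := by positivity
    field_simp
  have hlim' := (continuous_coe_real_ereal.tendsto (-lam)).comp hlim
  rw [← hlim'.limsup_eq]
  refine limsup_le_limsup (Eventually.of_forall fun k => ?_)
  simp only [Function.comp_apply, EReal.coe_div]
  refine EReal.div_le_div_right_of_nonneg (by exact_mod_cast (by positivity : 0 ≤ (k : ℝ) * Δ)) ?_
  refine (ENNReal.log_le_log (hx k)).trans ?_
  rw [ENNReal.log_ofReal_of_pos (Real.exp_pos _), Real.log_exp]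

lemma summable_inv_succ_sq : Summable fun k : ℕ => (((k : ℝ) + 1) ^ 2)⁻¹ := by
  have := (summable_nat_add_iff 1).2 (Real.summable_nat_pow_inv.2 (by norm_num : 1 < 2))
  simpa using this

/-- Exponential decay of the expectations implies the almost sure bound, up to a polynomial
factor. -/
lemma ae_exists_le_of_lintegral_le {Ω : Type*} [MeasurableSpace Ω] {P : Measure Ω}
    {X : ℕ → Ω → ℝ≥0∞} (hX : ∀ k, Measurable (X k)) {a q : ℝ}
    (h : ∀ k : ℕ, ∫⁻ ω, X k ω ∂P ≤ ENNReal.ofReal (a * Real.exp (-(k * q)))) :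
    ∀ᵐ ω ∂P, ∃ S : ℝ, 0 < S ∧ ∀ k : ℕ,
      X k ω ≤ ENNReal.ofReal (S * (((k : ℝ) + 1) ^ 2 * Real.exp (-(k * q)))) := by
  -- These weights cancel the exponential decay and leave a summable series of expectations, so the
  -- weighted sum of the X k is almost surely finite and bounds each of its terms.
  set u : ℕ → ℝ := fun k => (((k : ℝ) + 1) ^ 2)⁻¹ * Real.exp (k * q) with hu
  have hu0 : ∀ k, 0 < u k := fun k => by positivity
  have hfin : ∫⁻ ω, ∑' k, ENNReal.ofReal (u k) * X k ω ∂P ≠ ∞ := by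
    rw [lintegral_tsum fun k => ((hX k).const_mul _).aemeasurable]
    refine ne_top_of_le_ne_top (summable_inv_succ_sq.mul_left a).tsum_ofReal_ne_top ?_
    refine ENNReal.tsum_le_tsum fun k => ?_
    rw [lintegral_const_mul _ (hX k)]
    calc ENNReal.ofReal (u k) * ∫⁻ ω, X k ω ∂P
        ≤ ENNReal.ofReal (u k) * ENNReal.ofReal (a * Real.exp (-(k * q))) := by gcongr; exact h k
      _ = ENNReal.ofReal (a * (((k : ℝ) + 1) ^ 2)⁻¹) := by
          rw [← ENNReal.ofReal_mul (hu0 k).le]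
          congr 1
          have : Real.exp (k * q) * Real.exp (-(k * q)) = 1 := by rw [← Real.exp_add]; simp
          simp only [hu]
          linear_combination a * (((k : ℝ) + 1) ^ 2)⁻¹ * this
  have hae := ae_lt_top (Measurable.tsum fun k => (hX k).const_mul _) hfin
  filter_upwards [hae] with ω hω
  set S := ∑' k, ENNReal.ofReal (u k) * X k ω with hS
  -- Adding 1 makes the constant strictly positive, so that its logarithm can be used later.
  refine ⟨S.toReal + 1, by positivity, fun k => ?_⟩
  have h1 : ENNReal.ofReal (u k) * X k ω ≤ ENNReal.ofReal (S.toReal + 1) := by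
    refine (ENNReal.le_tsum (f := fun k => ENNReal.ofReal (u k) * X k ω) k).trans ?_
    rw [← hS, ← ENNReal.ofReal_toReal hω.ne]
    exact ENNReal.ofReal_le_ofReal (by simp)
  have h2 : (u k)⁻¹ = ((k : ℝ) + 1) ^ 2 * Real.exp (-(k * q)) := by
    simp only [hu, mul_inv, inv_inv, Real.exp_neg]
  rw [← h2, ← div_eq_mul_inv, ENNReal.ofReal_div_of_pos (hu0 k)]
  refine (ENNReal.le_div_iff_mul_le (Or.inl (by simpa using hu0 k)) (Or.inl (by simp))).2 ?_
  rw [mul_comm]; exact h1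

/-- The step sizes for which the one-step error is dominated. -/
lemma exists_step_threshold {K θ C ϱ Δs : ℝ} (hθ' : θ < 1 / 2)
    (hϱ : 0 < ϱ) (hΔs : 0 < Δs) :
    ∃ Δss : ℝ, 0 < Δss ∧ Δss ≤ Δs ∧ ∀ Δ : ℝ, 0 < Δ → Δ ≤ Δss →
      K * Δ ^ (-θ) * Δ ≤ 1 ∧ C * (K * Δ ^ (-θ) * Δ) ^ 2 ≤ ϱ * Δ := by
  have hlim : ∀ c e : ℝ, 0 < e → Tendsto (fun Δ : ℝ => c * Δ ^ e) (𝓝 0) (𝓝 0) := by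
    intro c e he
    have : Continuous fun Δ : ℝ => c * Δ ^ e :=
      continuous_const.mul (continuous_id.rpow_const fun _ => Or.inr he.le)
    simpa [Real.zero_rpow he.ne'] using this.tendsto 0
  have h1 := (hlim K (1 - θ) (by linarith)).eventually_lt_const one_pos
  -- Here θ < 1/2 is decisive: the squared error, divided by Δ, is CK²Δ^{1-2θ}, which tends to 0.
  have h2 := (hlim (C * K ^ 2) (1 - 2 * θ) (by linarith)).eventually_lt_const hϱ
  obtain ⟨ε, hε, hball⟩ := Metric.eventually_nhds_iff.1 (h1.and h2)
  refine ⟨min (ε / 2) Δs, by positivity, min_le_right _ _, fun Δ hΔ hΔ' => ?_⟩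
  obtain ⟨h3, h4⟩ := hball (y := Δ) (by
    rw [Real.dist_eq, sub_zero, abs_of_pos hΔ]
    linarith [hΔ'.trans (min_le_left _ _)])
  have h5 : K * Δ ^ (-θ) * Δ = K * Δ ^ (1 - θ) := by
    rw [mul_assoc, ← Real.rpow_add_one hΔ.ne']; congr 2; ring
  rw [h5]
  refine ⟨h3.le, ?_⟩
  have h6 : (Δ ^ (1 - θ)) ^ 2 = Δ ^ (1 - 2 * θ) * Δ := by
    rw [← Real.rpow_mul_natCast hΔ.le, ← Real.rpow_add_one hΔ.ne']; congr 1; push_cast; ring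
  calc C * (K * Δ ^ (1 - θ)) ^ 2 = C * K ^ 2 * Δ ^ (1 - 2 * θ) * Δ := by
        rw [mul_pow, h6]; ring
    _ ≤ ϱ * Δ := by gcongr

/-- The bound on the coefficients in a ball in terms of the truncation function. -/
lemma coeff_bounds {δ ρ μ R : ℝ}
    {V w : EuclideanSpace ℝ (Fin d) → ℝ} {φ : ℝ → ℝ}
    {f : EuclideanSpace ℝ (Fin d) → EuclideanSpace ℝ (Fin d)}
    {g : EuclideanSpace ℝ (Fin d) → Matrix (Fin d) (Fin m) ℝ}
    {z : EuclideanSpace ℝ (Fin d)} (hVz : 0 < V z) (hμ : 0 < μ) (hwV : μ * V z ^ ρ ≤ w z)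
    (hφR : 0 ≤ φ R)
    (hφ : max (‖f z‖ / (capRatio V w ρ z ^ (1 / 2 : ℝ) * V z ^ δ))
        (traceNorm (g z) ^ 2 / (capRatio V w ρ z * V z ^ (2 * δ))) ≤ φ R) :
    ‖f z‖ ≤ φ R * V z ^ δ ∧ traceNorm (g z) ^ 2 ≤ φ R * V z ^ (2 * δ) := by
  have hVρ : 0 < V z ^ ρ := Real.rpow_pos_of_pos hVz _
  have hw : 0 < w z := lt_of_lt_of_le (by positivity) hwV
  have hΛ : 0 < capRatio V w ρ z := lt_min one_pos (by positivity)
  -- The cap at 1 allows Λ to be dropped from the denominators; its positivity comes from w ≥ μV^ρ.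
  have hΛ1 : capRatio V w ρ z ≤ 1 := min_le_left _ _
  have hΛ2 : capRatio V w ρ z ^ (1 / 2 : ℝ) ≤ 1 := Real.rpow_le_one hΛ.le hΛ1 (by norm_num)
  have hV1 : 0 < V z ^ δ := Real.rpow_pos_of_pos hVz _
  have hV2 : 0 < V z ^ (2 * δ) := Real.rpow_pos_of_pos hVz _
  have h1 := (div_le_iff₀ (mul_pos (Real.rpow_pos_of_pos hΛ _) hV1)).1
    ((le_max_left _ _).trans hφ)
  have h2 := (div_le_iff₀ (mul_pos hΛ hV2)).1 ((le_max_right _ _).trans hφ)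
  exact ⟨h1.trans (mul_le_mul_of_nonneg_left (mul_le_of_le_one_left hV1.le hΛ2) hφR),
    h2.trans (mul_le_mul_of_nonneg_left (mul_le_of_le_one_left hV2.le hΛ1) hφR)⟩

end Decay

end VTruncatedEM

theorem corollary5p2
    {d m : ℕ} (hd : 0 < d) (hm : 0 < m)
    -- the driving Brownian motion
    {Ω : Type*} [MeasurableSpace Ω] (P : Measure Ω) [IsProbabilityMeasure P]
    (B : ℝ≥0 → Ω → EuclideanSpace ℝ (Fin m)) (hB : IsBrownianMotion B P)
    -- the coefficients
    (f : EuclideanSpace ℝ (Fin d) → EuclideanSpace ℝ (Fin d))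
    (g : EuclideanSpace ℝ (Fin d) → Matrix (Fin d) (Fin m) ℝ)
    (hfg : LocallyLipschitzCoeff f g) (hf0 : f 0 = 0) (hg0 : g 0 = 0)
    -- the Lyapunov function and the function `w`
    (ρ : ℝ) (hρ : 0 < ρ)
    (δ : ℝ) (hδ : ∃ r : ℕ, 4 ≤ r ∧ 1 / δ = (r : ℝ))
    (V : EuclideanSpace ℝ (Fin d) → ℝ) (hV : IsLyapunovClass 4 δ V)
    (hVscale : ∀ (x : EuclideanSpace ℝ (Fin d)) (ε : ℝ), 0 < ε → ε ≤ 1 → V (ε • x) ≤ V x)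
    (w : EuclideanSpace ℝ (Fin d) → ℝ) (hw : Continuous w) (hw_nonneg : ∀ x, 0 ≤ w x)
    (hLV : ∀ x, generator f g (fun y => V y ^ ρ) x ≤ -w x)
    (μ : ℝ) (hμ : 0 < μ) (hwV : ∀ x, μ * V x ^ ρ ≤ w x)
    -- the growth condition near and away from the origin
    (hgrowth : ∀ u : ℝ, 0 < u → BddAbove
      ((fun x => max (‖f x‖ ^ 2) (traceNorm (g x) ^ 2) / (capRatio V w ρ x * V x ^ (2 * δ))) ''
        {x : EuclideanSpace ℝ (Fin d) | 0 < ‖x‖ ∧ ‖x‖ ≤ u}))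
    -- the ingredients of the scheme
    (φ : ℝ → ℝ) (hφ_pos : ∀ u, 0 < u → 0 < φ u) (hφ_mono : StrictMonoOn φ (Ioi 0))
    (hφ_cont : ContinuousOn φ (Ioi 0)) (hφ_lim : Tendsto φ atTop atTop)
    (hφ : ∀ u : ℝ, 1 ≤ u → ∀ x : EuclideanSpace ℝ (Fin d), 0 < ‖x‖ → ‖x‖ ≤ u →
      max (‖f x‖ / (capRatio V w ρ x ^ (1 / 2 : ℝ) * V x ^ δ))
        (traceNorm (g x) ^ 2 / (capRatio V w ρ x * V x ^ (2 * δ))) ≤ φ u)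
    (x₀ : EuclideanSpace ℝ (Fin d))
    (θ : ℝ) (hθ : 0 < θ) (hθ' : θ < 1 / 2)
    (K : ℝ) (hK : 0 < K)
    (Δs : ℝ) (hΔs : 0 < Δs) (hΔs' : Δs < 1)
    (hKΔ : φ (max ‖x₀‖ 1) ≤ K * Δs ^ (-θ)) :
    ∀ ϱ : ℝ, 0 < ϱ → ϱ < μ →
      ∃ Δss : ℝ, 0 < Δss ∧ Δss ≤ Δs ∧ ∀ Δ : ℝ, 0 < Δ → Δ ≤ Δss →
        (limsup (fun k : ℕ =>
            ENNReal.log (∫⁻ ω, ENNReal.ofReal (V (scheme f g φ K θ x₀ B Δ k ω) ^ ρ) ∂P) /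
              (((k : ℝ) * Δ : ℝ) : EReal)) atTop ≤ ((-(μ - ϱ) : ℝ) : EReal)
          ∧ -(μ - ϱ) < 0) ∧
        ∀ᵐ ω ∂P, limsup (fun k : ℕ =>
            ENNReal.log (ENNReal.ofReal (V (scheme f g φ K θ x₀ B Δ k ω))) /
              (((k : ℝ) * Δ : ℝ) : EReal)) atTop ≤ ((-((μ - ϱ) / ρ) : ℝ) : EReal) := by
  obtain ⟨r, hr4, hr⟩ := hδ
  have hr0 : (4 : ℝ) ≤ r := by exact_mod_cast hr4
  have hδ0 : 0 < δ := one_div_pos.1 (hr ▸ (by linarith : (0 : ℝ) < r))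
  have hδr : δ * r = 1 := by rw [← hr]; field_simp
  have hδ4 : 4 * δ ≤ 1 := by nlinarith
  have hker : ∀ x, V x = 0 ↔ x = 0 := fun x => by
    have := hV.ker_eq
    rw [Set.ext_iff] at this
    simpa using this x
  intro ϱ hϱ hϱμ
  obtain ⟨C, hC0, hC⟩ := exists_lintegral_step_le (m := m) hd hδ0 hδ4 hδr hρ hV
  obtain ⟨Δss, hΔss, hΔss', hthr⟩ := exists_step_threshold (K := K) (C := C) hθ' hϱ hΔs
  refine ⟨Δss, hΔss, hΔss', fun Δ hΔ hΔle => ?_⟩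
  obtain ⟨hA1, hA2⟩ := hthr Δ hΔ hΔle
  set A : ℝ := K * Δ ^ (-θ) with hA
  have hA0 : 0 ≤ A := by positivity
  have hu : (1 : ℝ) ≤ max ‖x₀‖ 1 := le_max_right _ _
  -- Smaller steps enlarge the radius, so it stays at least ‖x₀‖ ∨ 1: the start lies in the ball,
  -- and the bound `hφ`, available only from radius 1 on, applies.
  have hφA : φ (max ‖x₀‖ 1) ≤ A := hKΔ.trans <| mul_le_mul_of_nonneg_left
    (Real.rpow_le_rpow_of_nonpos hΔ (hΔle.trans hΔss') (by linarith)) hK.le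
  obtain ⟨hφR, hR⟩ := inversePos_spec hφ_mono hφ_cont hφ_lim (by linarith) hφA
  have hR1 : 1 ≤ inversePos φ A := hu.trans hR
  set q : ℝ := (μ - ϱ) * Δ with hq
  have hstep : ∀ z : EuclideanSpace ℝ (Fin d), ‖z‖ ≤ inversePos φ A →
      ∫⁻ ξ : EuclideanSpace ℝ (Fin m), ENNReal.ofReal (V (eulerStep f g Δ z (√Δ • ξ)) ^ ρ)
        ∂(stdGaussian (EuclideanSpace ℝ (Fin m)))
      ≤ ENNReal.ofReal (Real.exp (-q)) * ENNReal.ofReal (V z ^ ρ) := by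
    intro z hz
    refine lintegral_eulerStep_le hρ hV hf0 hg0 hC hLV hwV hA0 hΔ.le hA1 hA2 fun hz0 => ?_
    have hVz : 0 < V z := lt_of_le_of_ne (hV.nonneg z) fun h => hz0 ((hker z).1 h.symm)
    have h := coeff_bounds hVz hμ (hwV z) (by rw [hφR]; exact hA0)
      (hφ (inversePos φ A) hR1 z (norm_pos_iff.2 hz0) hz)
    rwa [hφR] at h
  have hmom := hB.lintegral_scheme_le hfg (K := K) (θ := θ) (φ := φ) (x₀ := x₀) hΔ.le hρ
    hV.contDiff.continuous hV.nonneg hVscale (by linarith) ((le_max_left _ _).trans hR) hstep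
  have ha : 0 ≤ V x₀ ^ ρ := Real.rpow_nonneg (hV.nonneg _) _
  refine ⟨⟨?_, by linarith⟩, ?_⟩
  -- The added 1 covers x₀ = 0, where V(x₀)^ρ = 0.
  · refine limsup_log_div_le (c := Real.log (V x₀ ^ ρ + 1)) (κ := 0) hΔ fun k => ?_
    refine (hmom k).trans (ENNReal.ofReal_le_ofReal ?_)
    rw [zero_mul, add_zero, sub_eq_add_neg, Real.exp_add, Real.exp_log (by positivity), hq,
      mul_left_comm]
    gcongr
    linarith
  · have hae := ae_exists_le_of_lintegral_le (P := P)
      (X := fun k ω => ENNReal.ofReal (V (scheme f g φ K θ x₀ B Δ k ω) ^ ρ))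
      (fun k => ((hV.contDiff.continuous.measurable.comp
        (hB.measurable_scheme hfg φ K θ x₀ Δ k)).pow_const ρ).ennreal_ofReal) hmom
    filter_upwards [hae] with ω hω
    obtain ⟨S, hS, h⟩ := hω
    -- These constants come from taking the ρ-th root of S(k+1)²e^{-kq}.
    refine limsup_log_div_le (c := Real.log S / ρ) (κ := 2 / ρ) hΔ fun k => ?_
    refine ENNReal.ofReal_le_ofReal ?_
    have hk : (0 : ℝ) < (k : ℝ) + 1 := by positivity
    have h1 := (ENNReal.ofReal_le_ofReal_iff (by positivity)).1 (h k)
    have h2 : S * (((k : ℝ) + 1) ^ 2 * Real.exp (-(k * q)))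
        = Real.exp (Real.log S / ρ + 2 / ρ * Real.log (k + 1) - (μ - ϱ) / ρ * (k * Δ)) ^ ρ := by
      rw [← Real.exp_mul]
      have e : (Real.log S / ρ + 2 / ρ * Real.log (k + 1) - (μ - ϱ) / ρ * (k * Δ)) * ρ
          = Real.log S + (Real.log (k + 1) + Real.log (k + 1) + -(k * q)) := by
        rw [hq]; field_simp; ring
      rw [e, Real.exp_add, Real.exp_add, Real.exp_add, Real.exp_log hS, Real.exp_log hk, sq]
    rw [h2] at h1
    exact (Real.rpow_le_rpow_iff (hV.nonneg _) (Real.exp_pos _).le hρ).1 h1
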